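/- Let $(\Omega,\mathcal F,P)$ be a probability space and let $(\varepsilon_i)_{i\ge1}$ be independent, square-integrable random variables with $E(\varepsilon_i)=0$ and $E(\varepsilon_i^2)=1$ for all $i\ge 1$. Consider a one-step market with a riskless asset of return $0$ and risky assets with returns $$R_i=\mu_i+\bar\beta_i\varepsilon_i\quad(1\le i\le m),\qquad R_i=\mu_i+\sum_{j=1}^m\beta_i^j\varepsilon_j+\bar\beta_i\varepsilon_i\quad(i>m),$$ where $\mu_i,\beta_i^j,\bar\beta_i$ are real constants with $\bar\beta_i\neq0$. Put $b_i=-\mu_i/\bar\beta_i$ for $1\le i\le m$ and $b_i=-\mu_i/\bar\beta_i+\sum_{j=1}^m \mu_j\beta_i^j/(\bar\beta_j\bar\beta_i)$ for $i>m$. Assume that $\sum_{i}b_i^2<\infty$, that $P(\varepsilon_i>b_i)>0$ and $P(\varepsilon_i<b_i)>0$ for all $i\ge1$, and that $\sup_{i\ge1}E|\varepsilon_i|^3<\infty$. For $x\in\mathbb R$ and $h\in\ell_2$ let $V^{x,h}=x+\sum_{i\ge1}h_i(\varepsilon_i-b_i)$, the series converging in $L^2(P)$. Let $U:(0,\infty)\to\mathbb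 R$ be concave, strictly increasing and differentiable, extended by $U(0)=\lim_{y\downarrow0}U(y)\in[-\infty,\infty)$ and $U(y)=-\infty$ for $y<0$. Let $G$ be a random variable with $G\ge0$ a.s., and set $$\mathcal A(G,x)=\{h\in\ell_2: V^{x,h}\ge G\text{ a.s.}\},\qquad \pi(G)=\inf\{z\in\mathbb R:\mathcal A(G,z)\ne\emptyset\}\quad(\inf\emptyset=+\infty),$$ $$\mathcal A(U,G,x)=\{h\in\mathcal A(G,x): E\,U^+(V^{x,h}-G)<\infty\},\qquad u(G,x)=\sup_{h\in\mathcal A(U,G,x)}E\,U(V^{x,h}-G),$$ where the expectation $E\,U=E\,U^+-E\,U^-$ takes values in $[-\infty,\infty)$ and $u(G,x)=-\infty$ if $\mathcal A(U,G,x)=\emptyset$. Then, for every $x\in\mathbb R$ with $x\ge\pi(G)$, there exists $h^*\in\mathcal A(U,G,x)$ such that $u(G,x)=E\,U(V^{x,h^*}-G)$. -/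

import Mathlib

open MeasureTheory ProbabilityTheory Filter Topology
open scoped ENNReal

noncomputable section

/-- The large one-step market of Arbitrage Pricing Theory, with `m` factors, on a probability space
`(Ω, P)`. The risky assets and their random sources, numbered `1, 2, 3, …` in the usual notation,
are indexed here by `ℕ`, so that the index `i` stands for asset number `i + 1`, and the factors are
the sources with index `i < m`. The riskless asset has return zero and does not appear.
`μ i`, `β i j` (used only for `m ≤ i` and `j < m`) and `βbar i` are the constants of the model and
`ε i` are the square-integrable random sources. -/
structure LargeMarket {Ω : Type*} [MeasurableSpace Ω] (P : Measure Ω) where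
  m : ℕ
  μ : ℕ → ℝ
  β : ℕ → ℕ → ℝ
  βbar : ℕ → ℝ
  βbar_ne_zero : ∀ i, βbar i ≠ 0
  ε : ℕ → Ω → ℝ
  measurable_ε : ∀ i, Measurable (ε i)
  memLp_ε : ∀ i, MemLp (ε i) 2 P

namespace LargeMarket

variable {Ω : Type*} [MeasurableSpace Ω] {P : Measure Ω}

/-- The return of the risky asset `i`. -/
def assetReturn (M : LargeMarket P) (i : ℕ) (ω : Ω) : ℝ :=
  if i < M.m then M.μ i + M.βbar i * M.ε i ω
  else M.μ i + ∑ j ∈ Finset.range M.m, M.β i j * M.ε j ω + M.βbar i * M.ε i ω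

/-- The sequence `b` of the reparametrized model. -/
def b (M : LargeMarket P) (i : ℕ) : ℝ :=
  if i < M.m then -(M.μ i / M.βbar i)
  else -(M.μ i / M.βbar i)
    + ∑ j ∈ Finset.range M.m, M.μ j * M.β i j / (M.βbar j * M.βbar i)

/-- The reparametrization of the returns in terms of the variables `ε i - b i`. -/
theorem assetReturn_eq (M : LargeMarket P) (i : ℕ) (ω : Ω) :
    M.assetReturn i ω =
      if i < M.m then M.βbar i * (M.ε i ω - M.b i)
      else ∑ j ∈ Finset.range M.m, M.β i j * (M.ε j ω - M.b j)
        + M.βbar i * (M.ε i ω - M.b i) := by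
  have hi := M.βbar_ne_zero i
  by_cases h : i < M.m
  · simp only [assetReturn, b, h, if_true]
    field_simp
    ring
  · have h1 : ∑ j ∈ Finset.range M.m, M.β i j * (M.ε j ω - M.b j)
        = ∑ j ∈ Finset.range M.m, M.β i j * M.ε j ω
          + M.βbar i * ∑ j ∈ Finset.range M.m, M.μ j * M.β i j / (M.βbar j * M.βbar i) := by
      rw [Finset.mul_sum, ← Finset.sum_add_distrib]
      refine Finset.sum_congr rfl fun j hj => ?_
      have hj' := M.βbar_ne_zero j
      simp only [b, Finset.mem_range.1 hj, if_true]
      field_simp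
      ring
    simp only [h, if_false, h1]
    simp only [assetReturn, b, h, if_false]
    field_simp
    ring

/-- The sources are independent, centered and have unit variance (they are square-integrable by
`memLp_ε`). -/
structure SourcesStandard (M : LargeMarket P) : Prop where
  indep : iIndepFun M.ε P
  mean : ∀ i, ∫ ω, M.ε i ω ∂P = 0
  second_moment : ∀ i, ∫ ω, (M.ε i ω) ^ 2 ∂P = 1

/-- `b ∈ ℓ²`. -/
def SquareSummableB (M : LargeMarket P) : Prop := Summable fun i => (M.b i) ^ 2

/-- Each source takes values on both sides of `b i` with positive probability. -/
def NoArbitrage (M : LargeMarket P) : Prop :=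
  ∀ i, 0 < P {ω | M.b i < M.ε i ω} ∧ 0 < P {ω | M.ε i ω < M.b i}

/-- The third absolute moments of the sources are uniformly bounded. -/
def BoundedThirdMoments (M : LargeMarket P) : Prop :=
  ⨆ i, ∫⁻ ω, ENNReal.ofReal (|M.ε i ω| ^ 3) ∂P < ∞

variable [IsProbabilityMeasure P]

/-- `ε i - b i` as an element of `L²(P)`. -/
def source (M : LargeMarket P) (i : ℕ) : Lp ℝ 2 P :=
  ((M.memLp_ε i).sub (memLp_const (M.b i))).toLp (fun ω => M.ε i ω - M.b i)

/-- The value at time one of a portfolio in the first `n` risky assets,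
`x + ∑_{i < n} h i (ε i - b i)`. -/
def finiteValue (M : LargeMarket P) (x : ℝ) (h : ℕ → ℝ) (n : ℕ) : Lp ℝ 2 P :=
  Lp.const 2 P x + ∑ i ∈ Finset.range n, h i • M.source i

/-- The portfolio value `V^{x,h} = x + ∑ i, h i (ε i - b i)`, the limit in `L²(P)` of the values
of the finite portfolios. -/
def value (M : LargeMarket P) (x : ℝ) (h : lp (fun _ : ℕ => ℝ) 2) : Lp ℝ 2 P :=
  limUnder atTop (M.finiteValue x h)

/-- The `L²(P)` limit that defines `value` exists when the sources are standard and `b ∈ ℓ²`. -/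
theorem tendsto_finiteValue (M : LargeMarket P) (hM : M.SourcesStandard)
    (hb : M.SquareSummableB) (x : ℝ) (h : lp (fun _ : ℕ => ℝ) 2) :
    Tendsto (M.finiteValue x h) atTop (𝓝 (M.value x h)) := by
  have hh : Summable fun i => (h i) ^ 2 := by
    have := (lp.memℓp h).summable (by norm_num)
    simpa using this
  let e : ℕ → Lp ℝ 2 P := fun i => (M.memLp_ε i).toLp (M.ε i)
  have inner_e : ∀ i j, inner ℝ (e i) (e j) = ∫ ω, M.ε i ω * M.ε j ω ∂P := by
    intro i j
    rw [L2.inner_def]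
    refine integral_congr_ae ?_
    filter_upwards [(M.memLp_ε i).coeFn_toLp, (M.memLp_ε j).coeFn_toLp] with ω h1 h2
    simp [e, h1, h2, mul_comm]
  have he : Orthonormal ℝ e := by
    rw [orthonormal_iff_ite]
    intro i j
    rw [inner_e]
    split_ifs with hij
    · subst hij
      simpa [pow_two] using hM.second_moment i
    · rw [(hM.indep.indepFun hij).integral_fun_mul_eq_mul_integral
        (M.measurable_ε i).aestronglyMeasurable (M.measurable_ε j).aestronglyMeasurable,
        hM.mean i, zero_mul]
  have s1 : Summable fun i => h i • e i := by
    have := (he.orthogonalFamily.summable_iff_norm_sq_summable (fun i => h i)).2 (by simpa using hh)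
    simpa using this
  have s2 : Summable fun i => h i * M.b i := by
    refine Summable.of_norm_bounded (hh.add hb) fun i => ?_
    rw [Real.norm_eq_abs, abs_mul, ← sq_abs (h i), ← sq_abs (M.b i)]
    nlinarith [sq_nonneg (|h i| - |M.b i|), sq_nonneg (|h i|), sq_nonneg |M.b i|]
  have s3 : Summable fun i => h i • M.source i := by
    have h3 : Summable fun i => Lp.constL 2 P ℝ (h i * M.b i) :=
      s2.mapL (Lp.constL 2 P ℝ)
    refine (s1.sub h3).congr fun i => ?_
    have : M.source i = e i - Lp.constL 2 P ℝ (M.b i) := by rfl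
    rw [this, smul_sub, ← map_smul, smul_eq_mul]
  exact tendsto_nhds_limUnder
    ⟨_, (s3.hasSum.tendsto_sum_nat.const_add (Lp.const 2 P x))⟩

/-- `𝒜(G, x)`: the strategies in `ℓ²` that superreplicate `G` from the initial wealth `x`. -/
def superhedges (M : LargeMarket P) (G : Ω → ℝ) (x : ℝ) : Set (lp (fun _ : ℕ => ℝ) 2) :=
  {h | ∀ᵐ ω ∂P, G ω ≤ M.value x h ω}

/-- The superreplication price `π(G)`, equal to `+∞` if `G` cannot be superreplicated. -/
def superPrice (M : LargeMarket P) (G : Ω → ℝ) : EReal :=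
  sInf {z : EReal | ∃ x : ℝ, z = x ∧ (M.superhedges G x).Nonempty}

end LargeMarket

/-- A utility function `U` on `]0, ∞[` (the values of `U` elsewhere play no role), extended by
right-continuity at `0`, where the value may be `-∞`, and by `-∞` on `]-∞, 0[`. -/
def extendUtility (U : ℝ → ℝ) (y : ℝ) : EReal :=
  if 0 < y then (U y : EReal)
  else if y = 0 then Function.rightLim (fun z : ℝ => (U z : EReal)) 0
  else ⊥

/-- The positive part `E X⁺` of the expectation of an extended real random variable. -/
def posExpectation {Ω : Type*} [MeasurableSpace Ω] (P : Measure Ω) (X : Ω → EReal) : ℝ≥0∞ :=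
  ∫⁻ ω, (X ω).toENNReal ∂P

/-- The expectation `E X = E X⁺ - E X⁻`, used only where `E X⁺ < ∞`; it may be `-∞`. -/
def extExpectation {Ω : Type*} [MeasurableSpace Ω] (P : Measure Ω) (X : Ω → EReal) : EReal :=
  (posExpectation P X : EReal) - (posExpectation P (fun ω => -X ω) : EReal)

namespace LargeMarket

variable {Ω : Type*} [MeasurableSpace Ω] {P : Measure Ω} [IsProbabilityMeasure P]

/-- The random variable `U(V^{x,h} - G)`. -/
def terminalUtility (M : LargeMarket P) (U : ℝ → ℝ) (G : Ω → ℝ) (x : ℝ)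
    (h : lp (fun _ : ℕ => ℝ) 2) (ω : Ω) : EReal :=
  extendUtility U (M.value x h ω - G ω)

/-- `𝒜(U, G, x)`: the strategies that superreplicate `G` from `x` and have
`E U⁺(V^{x,h} - G) < ∞`. -/
def admissible (M : LargeMarket P) (U : ℝ → ℝ) (G : Ω → ℝ) (x : ℝ) :
    Set (lp (fun _ : ℕ => ℝ) 2) :=
  {h | posExpectation P (M.terminalUtility U G x h) < ∞} ∩ M.superhedges G x

/-- `u(G, x)`: the supremum of the expected utility over admissible strategies, equal to `-∞` if
there are none. -/
def maxUtility (M : LargeMarket P) (U : ℝ → ℝ) (G : Ω → ℝ) (x : ℝ) : EReal :=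
  ⨆ h ∈ M.admissible U G x, extExpectation P (M.terminalUtility U G x h)

end LargeMarket

end

/-! The upper level sets of the expected utility, for levels increasing to the supremum, form a
decreasing sequence of nonempty convex closed bounded sets of strategies in `ℓ²`. By weak
compactness, here in the elementary form of `iInter_nonempty_of_antitone_convex`, they have a common
point, and this point is optimal.

Boundedness (`exists_norm_le_of_gain_ge`): since `G ≥ 0`, a superhedging strategy loses at most `x`,
so an unbounded family, once normalized, gives unit vectors whose losses tend to `0`. For a gain
bounded below by `-δ`, the `L¹` norm exceeds the mean `-⟨b, g⟩` by at most `2δ`. Bounded third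
moments yield a Khintchine inequality that keeps the `L¹` norm of `∑ g i ε i` away from `0`, so `⟨b,
g⟩` stays below a negative constant. This condition passes to weak limits, and a limit strategy is a
nonzero one with nonnegative gain. Such an arbitrage is excluded by independence
(`eq_zero_of_gain_nonneg`).

Convexity and closedness: `U` lies below an affine function `A` that is nonnegative on `[0, ∞[`, and
`A - U` is there a supremum of affine functions, namely `A` minus the tangents. The expected utility
is thus the expectation of `A`, affine and continuous in the strategy, minus that of a nonnegative
convex lower semicontinuous function, to which Fatou's lemma applies. -/

/-! ### Decreasing convex sets in a Hilbert space -/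

/-- In a Hilbert space, a decreasing sequence of nonempty bounded closed convex sets has a common
point. -/
theorem iInter_nonempty_of_antitone_convex {E : Type*} [NormedAddCommGroup E]
    [InnerProductSpace ℝ E] [CompleteSpace E] {K : ℕ → Set E} (hanti : Antitone K)
    (hne : ∀ n, (K n).Nonempty) (hclosed : ∀ n, IsClosed (K n)) (hconv : ∀ n, Convex ℝ (K n))
    {R : ℝ} (hR : ∀ y ∈ K 0, ‖y‖ ≤ R) : (⋂ n, K n).Nonempty := by
  have hmin : ∀ n, ∃ v ∈ K n, ∀ w ∈ K n, inner ℝ (0 - v) (w - v) ≤ 0 := by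
    intro n
    obtain ⟨v, hv, h⟩ := exists_norm_eq_iInf_of_complete_convex (hne n) (hclosed n).isComplete
      (hconv n) 0
    exact ⟨v, hv, (norm_eq_iInf_iff_real_inner_le_zero (hconv n) hv).1 h⟩
  choose p hp hpmin using hmin
  -- The variational inequality for the point `p n` of least norm, tested at `p k ∈ K n`. The
  -- squared norms increase and are bounded, hence converge, and this inequality makes `p` Cauchy.
  have key : ∀ n k, n ≤ k → ‖p k - p n‖ ^ 2 ≤ ‖p k‖ ^ 2 - ‖p n‖ ^ 2 := by
    intro n k hnk
    have h1 := hpmin n (p k) (hanti hnk (hp k))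
    rw [zero_sub, inner_neg_left, inner_sub_right, real_inner_self_eq_norm_sq] at h1
    rw [norm_sub_sq_real, real_inner_comm]
    linarith
  have hmono : Monotone fun n => ‖p n‖ ^ 2 := fun n k hnk => by
    have := key n k hnk
    have := sq_nonneg ‖p k - p n‖
    simp only
    linarith
  have hbdd : BddAbove (Set.range fun n => ‖p n‖ ^ 2) := by
    refine ⟨R ^ 2, ?_⟩
    rintro _ ⟨n, rfl⟩
    exact pow_le_pow_left₀ (norm_nonneg _) (hR _ (hanti (Nat.zero_le n) (hp n))) 2
  have hcau0 := (tendsto_atTop_ciSup hmono hbdd).cauchySeq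
  have hcau : CauchySeq p := by
    rw [Metric.cauchySeq_iff'] at hcau0 ⊢
    intro δ hδ
    obtain ⟨N, hN⟩ := hcau0 (δ ^ 2) (by positivity)
    refine ⟨N, fun n hn => ?_⟩
    have h1 := hN n hn
    rw [Real.dist_eq] at h1
    have h2 := key N n hn
    have h3 := le_abs_self (‖p n‖ ^ 2 - ‖p N‖ ^ 2)
    rw [dist_eq_norm]
    exact lt_of_pow_lt_pow_left₀ 2 hδ.le (by linarith)
  obtain ⟨v, hv⟩ := cauchySeq_tendsto_of_complete hcau
  refine ⟨v, Set.mem_iInter.2 fun n => ?_⟩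
  refine (hclosed n).mem_of_tendsto hv ?_
  filter_upwards [eventually_ge_atTop n] with k hk
  exact hanti hk (hp k)

/-! ### Third moments and a Khintchine type inequality -/

/-- A Taylor bound for `|·|³` that keeps the sign of the linear term, so that this term has mean
zero when `y` is a centered variable independent of `s`. -/
theorem abs_add_pow_three_le (s y : ℝ) :
    |s + y| ^ 3 ≤ |s| ^ 3 + 3 * (s * |s|) * y + 3 * |s| * y ^ 2 + |y| ^ 3 := by
  rcases abs_cases s with ⟨h1, h1'⟩ | ⟨h1, h1'⟩ <;> rcases abs_cases y with ⟨h2, h2'⟩ | ⟨h2, h2'⟩ <;>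
    rcases abs_cases (s + y) with ⟨h3, h3'⟩ | ⟨h3, h3'⟩ <;> rw [h1, h2, h3]
  · nlinarith
  · nlinarith
  · have : 0 ≤ (-y) ^ 3 := pow_nonneg (by linarith) 3
    have : y ^ 3 = -(-y) ^ 3 := by ring
    nlinarith
  · have : 0 ≤ s * (s ^ 2 + 3 * s * y + 3 * y ^ 2) :=
      mul_nonneg h1' (by nlinarith [sq_nonneg (s + y), sq_nonneg (s + 2 * y)])
    nlinarith
  · have : 0 ≤ (-s) * (s ^ 2 + 3 * s * y + 3 * y ^ 2) :=
      mul_nonneg (by linarith) (by nlinarith [sq_nonneg (s + y), sq_nonneg (s + 2 * y)])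
    nlinarith
  · have : 0 ≤ y ^ 3 := pow_nonneg h2' 3
    nlinarith
  · nlinarith
  · nlinarith

section Khintchine

variable {Ω : Type*} [MeasurableSpace Ω] {P : Measure Ω}
  {ε : ℕ → Ω → ℝ}

theorem integrable_abs_pow_three {f : Ω → ℝ} (hf : MemLp f 3 P) :
    Integrable (fun ω => |f ω| ^ 3) P := by
  simpa using hf.integrable_norm_pow (p := 3) (by norm_num)

theorem memLp_weighted_sum {p : ℝ≥0∞} (hL : ∀ i, MemLp (ε i) p P) (h : ℕ → ℝ) (n : ℕ) :
    MemLp (fun ω => ∑ i ∈ Finset.range n, h i * ε i ω) p P :=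
  memLp_finsetSum _ fun i _ => (hL i).const_mul (h i)

theorem indepFun_weighted_sum (hmeas : ∀ i, Measurable (ε i)) (hind : iIndepFun ε P)
    (h : ℕ → ℝ) (n : ℕ) :
    IndepFun (fun ω => ∑ i ∈ Finset.range n, h i * ε i ω) (fun ω => h n * ε n ω) P := by
  have := (hind.comp (fun i y => h i * y) (fun i => measurable_const_mul _)).indepFun_finsetSum_of_notMem
    (fun i => (hmeas i).const_mul _) (s := Finset.range n) (i := n) (by simp)
  convert this using 1
  · ext ω
    simp
  · rfl

theorem integral_sq_weighted_sum (hmeas : ∀ i, Measurable (ε i)) (hind : iIndepFun ε P)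
    (hL : ∀ i, MemLp (ε i) 2 P) (hmean : ∀ i, ∫ ω, ε i ω ∂P = 0)
    (hvar : ∀ i, ∫ ω, ε i ω ^ 2 ∂P = 1) (h : ℕ → ℝ) (n : ℕ) :
    ∫ ω, (∑ i ∈ Finset.range n, h i * ε i ω) ^ 2 ∂P = ∑ i ∈ Finset.range n, h i ^ 2 := by
  induction n with
  | zero => simp
  | succ n ih =>
    set S : Ω → ℝ := fun ω => ∑ i ∈ Finset.range n, h i * ε i ω with hS
    have hSL : MemLp S 2 P := memLp_weighted_sum hL h n
    have hYL : MemLp (fun ω => h n * ε n ω) 2 P := (hL n).const_mul _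
    have hprod : Integrable (fun ω => S ω * (h n * ε n ω)) P := hSL.integrable_mul hYL
    have hsum : Integrable (fun ω => S ω ^ 2 + 2 * (S ω * (h n * ε n ω))) P :=
      hSL.integrable_sq.add (hprod.const_mul 2)
    have hcross : ∫ ω, S ω * (h n * ε n ω) ∂P = 0 := by
      rw [(indepFun_weighted_sum hmeas hind h n).integral_fun_mul_eq_mul_integral
        hSL.1 hYL.1, integral_const_mul, hmean, mul_zero, mul_zero]
    calc ∫ ω, (∑ i ∈ Finset.range (n + 1), h i * ε i ω) ^ 2 ∂P
        = ∫ ω, (S ω ^ 2 + 2 * (S ω * (h n * ε n ω)) + h n ^ 2 * ε n ω ^ 2) ∂P := by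
          congr 1 with ω
          rw [Finset.sum_range_succ]
          ring
      _ = _ := by
          rw [integral_add hsum
            ((hL n).integrable_sq.const_mul _), integral_add hSL.integrable_sq
            (hprod.const_mul 2), integral_const_mul, integral_const_mul, hcross, hvar, ih,
            Finset.sum_range_succ]
          ring

variable [IsProbabilityMeasure P]

/-- Adding one term `Y = h n ε n` to `S` costs at most `3 E|S| E Y² + E|Y|³`, the linear term
vanishing by independence. As `E S² ≤ 1` and `|h n| ≤ 1`, this is at most `(3 + C) h n ^ 2`. -/
theorem integral_abs_pow_three_weighted_sum_le (hmeas : ∀ i, Measurable (ε i))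
    (hind : iIndepFun ε P) (hL : ∀ i, MemLp (ε i) 3 P) (hmean : ∀ i, ∫ ω, ε i ω ∂P = 0)
    (hvar : ∀ i, ∫ ω, ε i ω ^ 2 ∂P = 1) {C : ℝ} (hC : ∀ i, ∫ ω, |ε i ω| ^ 3 ∂P ≤ C)
    (h : ℕ → ℝ) (n : ℕ) (hn : ∑ i ∈ Finset.range n, h i ^ 2 ≤ 1) :
    ∫ ω, |∑ i ∈ Finset.range n, h i * ε i ω| ^ 3 ∂P
      ≤ (3 + C) * ∑ i ∈ Finset.range n, h i ^ 2 := by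
  have hL2 : ∀ i, MemLp (ε i) 2 P := fun i => (hL i).mono_exponent (by norm_num)
  have hC0 : 0 ≤ C := (integral_nonneg fun ω => by positivity).trans (hC 0)
  induction n with
  | zero => simp
  | succ n ih =>
    rw [Finset.sum_range_succ] at hn
    have hn' : ∑ i ∈ Finset.range n, h i ^ 2 ≤ 1 := by nlinarith [sq_nonneg (h n)]
    have hq0 : 0 ≤ ∑ i ∈ Finset.range n, h i ^ 2 := Finset.sum_nonneg fun i _ => sq_nonneg _
    specialize ih hn'
    set S : Ω → ℝ := fun ω => ∑ i ∈ Finset.range n, h i * ε i ω with hS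
    set Y : Ω → ℝ := fun ω => h n * ε n ω with hY
    have hSL : MemLp S 3 P := memLp_weighted_sum hL h n
    have hSL2 : MemLp S 2 P := memLp_weighted_sum hL2 h n
    have hYL : MemLp Y 3 P := (hL n).const_mul _
    have hYL2 : MemLp Y 2 P := (hL2 n).const_mul _
    have hindSY : IndepFun S Y P := indepFun_weighted_sum hmeas hind h n
    have hSabs : Integrable (fun ω => S ω * |S ω|) P := hSL2.integrable_mul hSL2.abs
    have hSa : Integrable (fun ω => |S ω|) P := (hSL2.integrable (by norm_num)).abs
    have hi1 : IndepFun (fun ω => S ω * |S ω|) Y P :=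
      hindSY.comp (φ := fun s => s * |s|) (ψ := id) (by fun_prop) measurable_id
    have hi2 : IndepFun (fun ω => |S ω|) (fun ω => Y ω ^ 2) P :=
      hindSY.comp (φ := fun s => |s|) (ψ := fun y => y ^ 2) (by fun_prop) (by fun_prop)
    have hp1 : Integrable (fun ω => S ω * |S ω| * Y ω) P :=
      hi1.integrable_mul hSabs (hYL2.integrable (by norm_num))
    have hp2 : Integrable (fun ω => |S ω| * Y ω ^ 2) P :=
      hi2.integrable_mul hSa hYL2.integrable_sq
    have hc1 : ∫ ω, S ω * |S ω| * Y ω ∂P = 0 := by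
      rw [hi1.integral_fun_mul_eq_mul_integral hSabs.1 hYL.1, hY, integral_const_mul, hmean,
        mul_zero, mul_zero]
    have hYsq : ∫ ω, Y ω ^ 2 ∂P = h n ^ 2 := by
      simp only [hY, mul_pow]
      rw [integral_const_mul, hvar, mul_one]
    have hc2 : ∫ ω, |S ω| * Y ω ^ 2 ∂P = (∫ ω, |S ω| ∂P) * h n ^ 2 := by
      rw [hi2.integral_fun_mul_eq_mul_integral hSa.1 hYL2.integrable_sq.1, hYsq]
    have hS1 : ∫ ω, |S ω| ∂P ≤ 1 := by
      have h1 : ∫ ω, |S ω| ∂P ≤ ∫ ω, (1 / 2 + 1 / 2 * S ω ^ 2) ∂P := by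
        refine integral_mono hSa ((integrable_const _).add (hSL2.integrable_sq.const_mul _))
          fun ω => ?_
        have := sq_nonneg (|S ω| - 1)
        have := sq_abs (S ω)
        simp only
        nlinarith
      rw [integral_add (integrable_const _) (hSL2.integrable_sq.const_mul _), integral_const_mul,
        integral_sq_weighted_sum hmeas hind hL2 hmean hvar h n] at h1
      simp at h1
      linarith
    have hY3 : ∫ ω, |Y ω| ^ 3 ∂P ≤ C * h n ^ 2 := by
      have : ∀ ω, |Y ω| ^ 3 = |h n| ^ 3 * |ε n ω| ^ 3 := fun ω => by
        rw [hY]; simp only [abs_mul, mul_pow]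
      simp only [this]
      rw [integral_const_mul]
      have h1 : |h n| ≤ 1 := by
        rw [← sq_le_one_iff_abs_le_one]; linarith
      have h2 : |h n| ^ 3 ≤ h n ^ 2 := by
        rw [← sq_abs (h n), pow_succ]
        exact mul_le_of_le_one_right (by positivity) h1
      have h3 : 0 ≤ ∫ ω, |ε n ω| ^ 3 ∂P := integral_nonneg fun ω => by positivity
      calc _ ≤ h n ^ 2 * C := mul_le_mul h2 (hC n) h3 (by positivity)
        _ = _ := mul_comm _ _
    have hint1 : Integrable (fun ω => |S ω| ^ 3 + 3 * (S ω * |S ω| * Y ω)) P :=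
      (integrable_abs_pow_three hSL).add (hp1.const_mul 3)
    have hint2 : Integrable
        (fun ω => |S ω| ^ 3 + 3 * (S ω * |S ω| * Y ω) + 3 * (|S ω| * Y ω ^ 2)) P :=
      hint1.add (hp2.const_mul 3)
    calc ∫ ω, |∑ i ∈ Finset.range (n + 1), h i * ε i ω| ^ 3 ∂P
        ≤ ∫ ω, (|S ω| ^ 3 + 3 * (S ω * |S ω| * Y ω) + 3 * (|S ω| * Y ω ^ 2) + |Y ω| ^ 3) ∂P := by
          refine integral_mono
            (integrable_abs_pow_three (memLp_weighted_sum hL h (n + 1)))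
            (hint2.add (integrable_abs_pow_three hYL)) fun ω => ?_
          simp only
          rw [Finset.sum_range_succ]
          refine (abs_add_pow_three_le (S ω) (Y ω)).trans (le_of_eq ?_)
          ring
      _ = (∫ ω, |S ω| ^ 3 ∂P) + 3 * ((∫ ω, |S ω| ∂P) * h n ^ 2) + ∫ ω, |Y ω| ^ 3 ∂P := by
          rw [integral_add hint2 (integrable_abs_pow_three hYL), integral_add hint1
            (hp2.const_mul 3), integral_add (integrable_abs_pow_three hSL) (hp1.const_mul 3),
            integral_const_mul, integral_const_mul, hc1, hc2]
          ring
      _ ≤ _ := by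
          rw [Finset.sum_range_succ]
          have : (∫ ω, |S ω| ∂P) * h n ^ 2 ≤ 1 * h n ^ 2 :=
            mul_le_mul_of_nonneg_right hS1 (sq_nonneg _)
          nlinarith

/-- A Khintchine type inequality for independent standardized variables with bounded third
moments. -/
theorem sum_sq_le_integral_abs_weighted_sum (hmeas : ∀ i, Measurable (ε i))
    (hind : iIndepFun ε P) (hL : ∀ i, MemLp (ε i) 3 P) (hmean : ∀ i, ∫ ω, ε i ω ∂P = 0)
    (hvar : ∀ i, ∫ ω, ε i ω ^ 2 ∂P = 1) {C : ℝ} (hC : ∀ i, ∫ ω, |ε i ω| ^ 3 ∂P ≤ C)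
    (h : ℕ → ℝ) (n : ℕ) (hn : ∑ i ∈ Finset.range n, h i ^ 2 ≤ 1) :
    ∑ i ∈ Finset.range n, h i ^ 2
      ≤ (3 + C) * ∫ ω, |∑ i ∈ Finset.range n, h i * ε i ω| ∂P := by
  have hL2 : ∀ i, MemLp (ε i) 2 P := fun i => (hL i).mono_exponent (by norm_num)
  have hC0 : 0 ≤ C := (integral_nonneg fun ω => by positivity).trans (hC 0)
  have h3 := integral_abs_pow_three_weighted_sum_le hmeas hind hL hmean hvar hC h n hn
  have h2 := integral_sq_weighted_sum hmeas hind hL2 hmean hvar h n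
  set S : Ω → ℝ := fun ω => ∑ i ∈ Finset.range n, h i * ε i ω with hS
  have hSL2 : MemLp S 2 P := memLp_weighted_sum hL2 h n
  have hS3 := integrable_abs_pow_three (memLp_weighted_sum hL h n)
  have hSa : Integrable (fun ω => |S ω|) P := (hSL2.integrable (by norm_num)).abs
  have ha : 0 < 3 + C := by linarith
  -- The inequality of means `2 S² ≤ a |S| + a⁻¹ |S|³` with `a = 3 + C`, chosen so that the cubic
  -- term absorbs exactly one of the two copies of `E S²`.
  have key : ∫ ω, 2 * S ω ^ 2 ∂P ≤ ∫ ω, ((3 + C) * |S ω| + (3 + C)⁻¹ * |S ω| ^ 3) ∂P := by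
    refine integral_mono (hSL2.integrable_sq.const_mul _)
      ((hSa.const_mul _).add (hS3.const_mul _)) fun ω => ?_
    have h4 : (3 + C) * |S ω| + (3 + C)⁻¹ * |S ω| ^ 3 - 2 * S ω ^ 2
        = |S ω| * (3 + C)⁻¹ * ((3 + C) - |S ω|) ^ 2 := by
      rw [← sq_abs (S ω)]
      field_simp
      ring
    have h5 : 0 ≤ |S ω| * (3 + C)⁻¹ * ((3 + C) - |S ω|) ^ 2 := by positivity
    simp only
    linarith
  rw [integral_add (hSa.const_mul _) (hS3.const_mul _), integral_const_mul, integral_const_mul,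
    integral_const_mul, h2] at key
  have h6 : (3 + C)⁻¹ * ∫ ω, |S ω| ^ 3 ∂P ≤ ∑ i ∈ Finset.range n, h i ^ 2 := by
    rw [inv_mul_le_iff₀ ha]
    exact h3
  linarith

end Khintchine

/-! ### Gains as a continuous linear map from `ℓ²` to `L²(P)` -/

noncomputable section

namespace LargeMarket

variable {Ω : Type*} [MeasurableSpace Ω] {P : Measure Ω} [IsProbabilityMeasure P]

/-- `ε i` as an element of `L²(P)`. -/
def noise (M : LargeMarket P) (i : ℕ) : Lp ℝ 2 P := (M.memLp_ε i).toLp (M.ε i)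

theorem source_eq (M : LargeMarket P) (i : ℕ) :
    M.source i = M.noise i - Lp.constL 2 P ℝ (M.b i) := rfl

omit [IsProbabilityMeasure P] in
theorem coeFn_noise (M : LargeMarket P) (i : ℕ) : M.noise i =ᵐ[P] M.ε i :=
  (M.memLp_ε i).coeFn_toLp

theorem coeFn_source (M : LargeMarket P) (i : ℕ) :
    M.source i =ᵐ[P] fun ω => M.ε i ω - M.b i := by
  unfold source
  exact MemLp.coeFn_toLp _

omit [IsProbabilityMeasure P] in
theorem orthonormal_noise (M : LargeMarket P) (hM : M.SourcesStandard) :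
    Orthonormal ℝ M.noise := by
  rw [orthonormal_iff_ite]
  intro i j
  have inner_e : inner ℝ (M.noise i) (M.noise j) = ∫ ω, M.ε i ω * M.ε j ω ∂P := by
    rw [L2.inner_def]
    refine integral_congr_ae ?_
    filter_upwards [M.coeFn_noise i, M.coeFn_noise j] with ω h1 h2
    simp [h1, h2, mul_comm]
  rw [inner_e]
  split_ifs with hij
  · subst hij
    simpa [pow_two] using hM.second_moment i
  · rw [(hM.indep.indepFun hij).integral_fun_mul_eq_mul_integral
      (M.measurable_ε i).aestronglyMeasurable (M.measurable_ε j).aestronglyMeasurable,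
      hM.mean i, zero_mul]

/-- The isometry `h ↦ ∑ i, h i • ε i` from `ℓ²` to `L²(P)`. -/
def noiseSum (M : LargeMarket P) (hM : M.SourcesStandard) :
    lp (fun _ : ℕ => ℝ) 2 →ₗᵢ[ℝ] Lp ℝ 2 P :=
  (M.orthonormal_noise hM).orthogonalFamily.linearIsometry

omit [IsProbabilityMeasure P] in
theorem hasSum_noiseSum (M : LargeMarket P) (hM : M.SourcesStandard)
    (h : lp (fun _ : ℕ => ℝ) 2) : HasSum (fun i => h i • M.noise i) (M.noiseSum hM h) :=
  (M.orthonormal_noise hM).orthogonalFamily.hasSum_linearIsometry h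

/-- The sequence `b` as an element of `ℓ²`. -/
def bLp (M : LargeMarket P) (hb : M.SquareSummableB) : lp (fun _ : ℕ => ℝ) 2 :=
  ⟨M.b, memℓp_gen (by simpa [SquareSummableB] using hb)⟩

/-- The continuous linear map `h ↦ ∑ i, h i (ε i - b i)` from `ℓ²` to `L²(P)`. -/
def gain (M : LargeMarket P) (hM : M.SourcesStandard) (hb : M.SquareSummableB) :
    lp (fun _ : ℕ => ℝ) 2 →L[ℝ] Lp ℝ 2 P :=
  (M.noiseSum hM).toContinuousLinearMap - (Lp.constL 2 P ℝ).comp (innerSL ℝ (M.bLp hb))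

theorem gain_apply (M : LargeMarket P) (hM : M.SourcesStandard) (hb : M.SquareSummableB)
    (h : lp (fun _ : ℕ => ℝ) 2) :
    M.gain hM hb h = M.noiseSum hM h - Lp.constL 2 P ℝ (inner ℝ (M.bLp hb) h) := rfl

theorem hasSum_gain (M : LargeMarket P) (hM : M.SourcesStandard) (hb : M.SquareSummableB)
    (h : lp (fun _ : ℕ => ℝ) 2) : HasSum (fun i => h i • M.source i) (M.gain hM hb h) := by
  have h1 : HasSum (fun i => h i * M.b i) (inner ℝ (M.bLp hb) h) :=
    lp.hasSum_inner (𝕜 := ℝ) (M.bLp hb) h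
  refine ((M.hasSum_noiseSum hM h).sub (h1.mapL (Lp.constL 2 P ℝ))).congr fun s => ?_
  refine Finset.sum_congr rfl fun i _ => ?_
  have h2 : h i • M.source i = h i • M.noise i - Lp.constL 2 P ℝ (h i * M.b i) := by
    rw [source_eq, smul_sub, ← map_smul, smul_eq_mul]
  exact h2.symm

theorem value_eq (M : LargeMarket P) (hM : M.SourcesStandard) (hb : M.SquareSummableB)
    (x : ℝ) (h : lp (fun _ : ℕ => ℝ) 2) :
    M.value x h = Lp.const 2 P x + M.gain hM hb h :=
  tendsto_nhds_unique (M.tendsto_finiteValue hM hb x h)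
    ((M.hasSum_gain hM hb h).tendsto_sum_nat.const_add _)

theorem coeFn_value (M : LargeMarket P) (hM : M.SourcesStandard) (hb : M.SquareSummableB)
    (x : ℝ) (h : lp (fun _ : ℕ => ℝ) 2) :
    M.value x h =ᵐ[P] fun ω => x + M.gain hM hb h ω := by
  rw [M.value_eq hM hb]
  filter_upwards [Lp.coeFn_add (Lp.const 2 P x) (M.gain hM hb h), Lp.coeFn_const 2 P x]
    with ω h1 h2
  rw [h1, Pi.add_apply, h2, Function.const_apply]

theorem gain_single (M : LargeMarket P) (hM : M.SourcesStandard) (hb : M.SquareSummableB)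
    (i : ℕ) (c : ℝ) : M.gain hM hb (lp.single 2 i c) = c • M.source i := by
  have h1 := M.hasSum_gain hM hb (lp.single 2 i c)
  have h2 := hasSum_single (f := fun j => (lp.single 2 i c : lp (fun _ : ℕ => ℝ) 2) j • M.source j) i
    (fun j hj => by rw [lp.single_apply_ne _ _ _ hj, zero_smul])
  rw [lp.single_apply_self] at h2
  exact h1.unique h2

theorem integral_eq_inner (f : Lp ℝ 2 P) :
    ∫ ω, f ω ∂P = inner ℝ (Lp.const 2 P (1 : ℝ)) f := by
  rw [L2.inner_def]
  refine integral_congr_ae ?_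
  filter_upwards [Lp.coeFn_const 2 P (1 : ℝ)] with ω h1
  rw [h1]
  simp

theorem integral_abs_eq_inner (f : Lp ℝ 2 P) :
    ∫ ω, |f ω| ∂P = inner ℝ (Lp.const 2 P (1 : ℝ)) |f| := by
  rw [L2.inner_def]
  refine integral_congr_ae ?_
  filter_upwards [Lp.coeFn_const 2 P (1 : ℝ), Lp.coeFn_abs f] with ω h1 h2
  rw [h1, h2]
  simp

theorem continuous_integral_abs : Continuous fun f : Lp ℝ 2 P => ∫ ω, |f ω| ∂P := by
  simp only [integral_abs_eq_inner]
  exact continuous_const.inner (continuous_id.sup continuous_neg)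

theorem integral_gain (M : LargeMarket P) (hM : M.SourcesStandard) (hb : M.SquareSummableB)
    (h : lp (fun _ : ℕ => ℝ) 2) :
    ∫ ω, M.gain hM hb h ω ∂P = -inner ℝ (M.bLp hb) h := by
  have h1 : ∀ i, inner ℝ (Lp.const 2 P (1 : ℝ)) (M.noise i) = 0 := fun i => by
    rw [← integral_eq_inner, integral_congr_ae (M.coeFn_noise i), hM.mean]
  have h2 := (M.hasSum_noiseSum hM h).mapL (innerSL ℝ (Lp.const 2 P (1 : ℝ)))
  simp only [innerSL_apply_apply, real_inner_smul_right, h1, mul_zero] at h2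
  have h3 : inner ℝ (Lp.const 2 P (1 : ℝ)) (Lp.constL 2 P ℝ (inner ℝ (M.bLp hb) h))
      = inner ℝ (M.bLp hb) h := by
    rw [← integral_eq_inner, Lp.constL_apply, integral_congr_ae (Lp.coeFn_const 2 P _)]
    simp
  rw [integral_eq_inner, gain_apply, inner_sub_right, h2.unique hasSum_zero, h3, zero_sub]

omit [IsProbabilityMeasure P] in
theorem exists_third_moment_bound (M : LargeMarket P) (h3 : M.BoundedThirdMoments) :
    (∀ i, MemLp (M.ε i) 3 P) ∧ ∃ C : ℝ, ∀ i, ∫ ω, |M.ε i ω| ^ 3 ∂P ≤ C := by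
  unfold BoundedThirdMoments at h3
  have hle := fun i => le_iSup (fun i => ∫⁻ ω, ENNReal.ofReal (|M.ε i ω| ^ 3) ∂P) i
  have hint : ∀ i, Integrable (fun ω => |M.ε i ω| ^ 3) P := by
    intro i
    refine ⟨by have := M.measurable_ε i; fun_prop, ?_⟩
    rw [hasFiniteIntegral_iff_ofReal (ae_of_all _ fun ω => by positivity)]
    exact (hle i).trans_lt h3
  refine ⟨fun i => ?_, (⨆ i, ∫⁻ ω, ENNReal.ofReal (|M.ε i ω| ^ 3) ∂P).toReal, fun i => ?_⟩
  · rw [← integrable_norm_rpow_iff (M.measurable_ε i).aestronglyMeasurable (by norm_num)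
      (by norm_num)]
    simpa using hint i
  · rw [integral_eq_lintegral_of_nonneg_ae (ae_of_all _ fun ω => by positivity) (hint i).1]
    exact ENNReal.toReal_mono h3.ne (hle i)

/-- A Khintchine type inequality: on the subspace spanned by the sources, the `L¹`
norm controls the `L²` norm. -/
theorem exists_integral_abs_noiseSum_ge (M : LargeMarket P) (hM : M.SourcesStandard)
    (h3 : M.BoundedThirdMoments) :
    ∃ c : ℝ, 0 < c ∧ ∀ h : lp (fun _ : ℕ => ℝ) 2, ‖h‖ = 1 →
      c ≤ ∫ ω, |M.noiseSum hM h ω| ∂P := by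
  obtain ⟨hL, C, hC⟩ := M.exists_third_moment_bound h3
  have hC0 : 0 ≤ C := (integral_nonneg fun ω => by positivity).trans (hC 0)
  refine ⟨(3 + C)⁻¹, by positivity, fun h hh => ?_⟩
  have hsum : HasSum (fun i => h i ^ 2) 1 := by
    have := lp.hasSum_inner (𝕜 := ℝ) h h
    rw [real_inner_self_eq_norm_sq, hh] at this
    simpa [pow_two] using this
  rw [inv_le_iff_one_le_mul₀' (by positivity)]
  refine le_of_tendsto_of_tendsto' hsum.tendsto_sum_nat
    (((continuous_integral_abs.tendsto _).comp
      (M.hasSum_noiseSum hM h).tendsto_sum_nat).const_mul (3 + C)) fun n => ?_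
  refine (sum_sq_le_integral_abs_weighted_sum M.measurable_ε hM.indep hL hM.mean
    hM.second_moment hC h n (sum_le_hasSum _ (fun i _ => sq_nonneg _) hsum)).trans (le_of_eq ?_)
  congr 1
  refine integral_congr_ae ?_
  have h1 : ∀ᵐ ω ∂P, ∀ i, (h i • M.noise i : Lp ℝ 2 P) ω = h i * M.ε i ω := by
    rw [ae_all_iff]
    intro i
    filter_upwards [Lp.coeFn_smul (h i) (M.noise i), M.coeFn_noise i] with ω h1 h2
    simp [h1, h2]
  filter_upwards [Lp.coeFn_finsetSum (Finset.range n) fun i => h i • M.noise i, h1] with ω h2 h4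
  rw [h2, Finset.sum_apply]
  simp only [h4]

end LargeMarket
end

/-! ### Independence and absence of arbitrage -/

noncomputable section

namespace LargeMarket

variable {Ω : Type*} [MeasurableSpace Ω] {P : Measure Ω} [IsProbabilityMeasure P]

/-- The `σ`-algebra generated by the sources other than `ε i`. -/
abbrev otherSources (M : LargeMarket P) (i : ℕ) : MeasurableSpace Ω :=
  ⨆ j ∈ ({i}ᶜ : Set ℕ), MeasurableSpace.comap (M.ε j) inferInstance

omit [IsProbabilityMeasure P] in
theorem otherSources_le (M : LargeMarket P) (i : ℕ) :
    M.otherSources i ≤ (inferInstance : MeasurableSpace Ω) :=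
  iSup₂_le fun j _ => (M.measurable_ε j).comap_le

omit [IsProbabilityMeasure P] in
theorem indep_otherSources (M : LargeMarket P) (hM : M.SourcesStandard) (i : ℕ) :
    Indep (MeasurableSpace.comap (M.ε i) inferInstance) (M.otherSources i) P := by
  have h := indep_iSup_of_disjoint (m := fun j => MeasurableSpace.comap (M.ε j) inferInstance)
    (fun j => (M.measurable_ε j).comap_le) hM.indep (S := {i}) (T := {i}ᶜ) disjoint_compl_right
  rwa [iSup_singleton] at h

/-- The finite partial sums do not involve `ε i`, and a.e. measurability for a sub-`σ`-algebra is a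
closed condition in `L²`. -/
theorem aestronglyMeasurable_gain (M : LargeMarket P) (hM : M.SourcesStandard)
    (hb : M.SquareSummableB) {h : lp (fun _ : ℕ => ℝ) 2} {i : ℕ} (hi : h i = 0) :
    AEStronglyMeasurable[M.otherSources i] (M.gain hM hb h) P := by
  have hcl := isClosed_aestronglyMeasurable (F := ℝ) (p := 2) (μ := P) (M.otherSources_le i)
  refine hcl.mem_of_tendsto (M.hasSum_gain hM hb h).tendsto_sum_nat (Eventually.of_forall fun n => ?_)
  refine mem_lpMeas_iff_aestronglyMeasurable (𝕜 := ℝ).1 (Submodule.sum_mem _ fun j _ => ?_)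
  by_cases hj : j = i
  · rw [hj, hi, zero_smul]
    exact Submodule.zero_mem _
  refine Submodule.smul_mem _ _ (mem_lpMeas_iff_aestronglyMeasurable.2 ?_)
  have hle : MeasurableSpace.comap (M.ε j) inferInstance ≤ M.otherSources i :=
    le_iSup₂_of_le (f := fun j (_ : j ∈ ({i}ᶜ : Set ℕ)) =>
      MeasurableSpace.comap (M.ε j) inferInstance) j hj le_rfl
  have hmeas : Measurable[M.otherSources i] (M.ε j) :=
    (comap_measurable (M.ε j)).mono hle le_rfl
  exact ⟨fun ω => M.ε j ω - M.b j, (hmeas.sub_const _).stronglyMeasurable, M.coeFn_source j⟩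

/-- If a gain is bounded below, it is still bounded below when one position is closed, and by a
better constant when this position may incur a loss. -/
theorem gain_sub_single_ge (M : LargeMarket P) (hM : M.SourcesStandard)
    (hb : M.SquareSummableB) {h : lp (fun _ : ℕ => ℝ) 2} {a δ : ℝ} (i : ℕ)
    (ha : ∀ᵐ ω ∂P, a ≤ M.gain hM hb h ω)
    (hδ : P {ω | h i * (M.ε i ω - M.b i) ≤ -δ} ≠ 0) :
    ∀ᵐ ω ∂P, a + δ ≤ M.gain hM hb (h - lp.single 2 i (h i)) ω := by
  set k := h - lp.single 2 i (h i) with hk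
  have hki : k i = 0 := by simp [hk]
  obtain ⟨R, hR, hRk⟩ := M.aestronglyMeasurable_gain hM hb hki
  have hsplit : ∀ᵐ ω ∂P, M.gain hM hb h ω = R ω + h i * (M.ε i ω - M.b i) := by
    have h1 : M.gain hM hb h = M.gain hM hb k + h i • M.source i := by
      rw [← M.gain_single hM hb, ← map_add, hk, sub_add_cancel]
    rw [h1]
    filter_upwards [Lp.coeFn_add (M.gain hM hb k) (h i • M.source i), hRk,
      Lp.coeFn_smul (h i) (M.source i), M.coeFn_source i] with ω h2 h3 h4 h5
    rw [h2, Pi.add_apply, h3, h4, Pi.smul_apply, h5, smul_eq_mul]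
  have hA : MeasurableSet[MeasurableSpace.comap (M.ε i) inferInstance]
      {ω | h i * (M.ε i ω - M.b i) ≤ -δ} :=
    ⟨{y | h i * (y - M.b i) ≤ -δ}, measurableSet_le (by fun_prop) (by fun_prop), rfl⟩
  have hB : MeasurableSet[M.otherSources i] {ω | R ω < a + δ} :=
    hR.measurable measurableSet_Iio
  -- The position loses at least `δ` on an event independent of the remaining gain `R`. Both this
  -- and `R < a + δ` would violate the lower bound `a`, so the product of their probabilities is
  -- zero.
  have hind := ((Indep_iff _ _ _).1 (M.indep_otherSources hM i)) _ _ hA hB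
  have h0 : P ({ω | h i * (M.ε i ω - M.b i) ≤ -δ} ∩ {ω | R ω < a + δ}) = 0 := by
    rw [measure_eq_zero_iff_ae_notMem]
    filter_upwards [ha, hsplit] with ω h1 h2
    rintro ⟨h3, h4⟩
    simp only [Set.mem_ofPred_eq] at h3 h4
    linarith
  rw [h0, eq_comm, mul_eq_zero, or_iff_right hδ, measure_eq_zero_iff_ae_notMem] at hind
  filter_upwards [hind, hRk] with ω h1 h2
  rw [h2]
  simpa using h1

/-- Absence of arbitrage in the infinite market. -/
theorem eq_zero_of_gain_nonneg (M : LargeMarket P) (hM : M.SourcesStandard)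
    (hb : M.SquareSummableB) (harb : M.NoArbitrage) {h : lp (fun _ : ℕ => ℝ) 2}
    (hh : ∀ᵐ ω ∂P, 0 ≤ M.gain hM hb h ω) : h = 0 := by
  by_contra hne
  obtain ⟨i, hi⟩ : ∃ i, h i ≠ 0 := by
    by_contra! hcon
    exact hne (lp.ext (funext hcon))
  have hneg : ∀ j, ∀ t : ℝ, t ≠ 0 → P {ω | t * (M.ε j ω - M.b j) < 0} ≠ 0 := by
    intro j t ht
    rcases ht.lt_or_gt with ht | ht
    · refine ((harb j).1.trans_le (measure_mono fun ω hω => ?_)).ne'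
      exact mul_neg_of_neg_of_pos ht (sub_pos.2 hω)
    · refine ((harb j).2.trans_le (measure_mono fun ω hω => ?_)).ne'
      exact mul_neg_of_pos_of_neg ht (sub_neg.2 hω)
  have hnonpos : ∀ j, ∀ t : ℝ, P {ω | t * (M.ε j ω - M.b j) ≤ -0} ≠ 0 := by
    intro j t
    rcases eq_or_ne t 0 with rfl | ht
    · simp
    · refine (lt_of_lt_of_le (pos_iff_ne_zero.2 (hneg j t ht)) (measure_mono fun ω hω => ?_)).ne'
      simp only [Set.mem_ofPred_eq, neg_zero] at hω ⊢
      exact hω.le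
  obtain ⟨δ, hδ0, hδ⟩ : ∃ δ > 0, P {ω | h i * (M.ε i ω - M.b i) ≤ -δ} ≠ 0 := by
    by_contra! hcon
    refine hneg i (h i) hi (measure_mono_null (t := ⋃ n : ℕ,
      {ω | h i * (M.ε i ω - M.b i) ≤ -(1 / ((n : ℝ) + 1))}) (fun ω hω => ?_)
      (measure_iUnion_null fun n => hcon _ (by positivity)))
    have hω' : h i * (M.ε i ω - M.b i) < 0 := hω
    obtain ⟨n, hn⟩ := exists_nat_one_div_lt (neg_pos.2 hω')
    exact Set.mem_iUnion.2 ⟨n, by simp only [Set.mem_ofPred_eq]; linarith⟩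
  set k := h - lp.single 2 i (h i) with hk
  have hkge : ∀ᵐ ω ∂P, δ ≤ M.gain hM hb k ω := by
    simpa only [zero_add] using M.gain_sub_single_ge hM hb i hh hδ
  -- One nonzero position has already raised the lower bound to `δ > 0`. Closing the others one by
  -- one never lowers it, whereas the tail of the gain tends to `0` in `L²`, a contradiction.
  have htail : ∀ n : ℕ, ∀ᵐ ω ∂P,
      δ ≤ M.gain hM hb (k - ∑ j ∈ Finset.range n, lp.single 2 j (k j)) ω := by
    intro n
    induction n with
    | zero => simpa using hkge
    | succ n ih =>
      have hcoord : (k - ∑ j ∈ Finset.range n, lp.single 2 j (k j) : lp (fun _ : ℕ => ℝ) 2) n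
          = k n := by
        have h1 : (∑ j ∈ Finset.range n, lp.single 2 j (k j) : lp (fun _ : ℕ => ℝ) 2) n = 0 := by
          rw [lp.coeFn_sum, Finset.sum_apply]
          refine Finset.sum_eq_zero fun j hj => ?_
          exact lp.single_apply_ne _ _ _ (Finset.mem_range.1 hj).ne'
        rw [lp.coeFn_sub, Pi.sub_apply, h1, sub_zero]
      have := M.gain_sub_single_ge hM hb n ih (hnonpos n _)
      rw [add_zero, hcoord, sub_sub, ← Finset.sum_range_succ] at this
      exact this
  have hlim : Tendsto (fun n : ℕ => ∫ ω, |M.gain hM hb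
      (k - ∑ j ∈ Finset.range n, lp.single 2 j (k j)) ω| ∂P) atTop (𝓝 0) := by
    have h1 := (lp.hasSum_single (E := fun _ : ℕ => ℝ) (p := 2) (by norm_num) k).tendsto_sum_nat
    have h2 := ((continuous_integral_abs (P := P)).comp (M.gain hM hb).continuous).tendsto (k - k)
    have h3 := h2.comp (h1.const_sub k)
    have h4 : ∫ ω, |(0 : Lp ℝ 2 P) ω| ∂P = 0 := by
      rw [integral_abs_eq_inner]
      simp
    simpa [Function.comp_def, h4] using h3
  have hge : ∀ n : ℕ, δ ≤ ∫ ω, |M.gain hM hb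
      (k - ∑ j ∈ Finset.range n, lp.single 2 j (k j)) ω| ∂P := by
    intro n
    have h1 : ∫ _, δ ∂P ≤ ∫ ω, |M.gain hM hb
        (k - ∑ j ∈ Finset.range n, lp.single 2 j (k j)) ω| ∂P := by
      refine integral_mono_ae (integrable_const _)
        ((Lp.memLp _).integrable (by norm_num)).abs ?_
      filter_upwards [htail n] with ω hω
      exact hω.trans (le_abs_self _)
    simpa using h1
  exact absurd (ge_of_tendsto' hlim hge) (not_le.2 hδ0)

end LargeMarket
end

/-! ### Boundedness of strategies with bounded losses -/

noncomputable section

namespace LargeMarket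

variable {Ω : Type*} [MeasurableSpace Ω] {P : Measure Ω} [IsProbabilityMeasure P]

theorem coeFn_gain_combo (M : LargeMarket P) (hM : M.SourcesStandard) (hb : M.SquareSummableB)
    (g h : lp (fun _ : ℕ => ℝ) 2) (s t : ℝ) :
    ∀ᵐ ω ∂P, M.gain hM hb (s • g + t • h) ω = s * M.gain hM hb g ω + t * M.gain hM hb h ω := by
  rw [map_add, map_smul, map_smul]
  filter_upwards [Lp.coeFn_add (s • M.gain hM hb g) (t • M.gain hM hb h),
    Lp.coeFn_smul s (M.gain hM hb g), Lp.coeFn_smul t (M.gain hM hb h)] with ω h1 h2 h3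
  rw [h1, Pi.add_apply, h2, h3]
  rfl

/-- A convergent sequence of strategies has a subsequence along which the gains converge almost
surely. -/
theorem exists_subseq_tendsto_gain (M : LargeMarket P) (hM : M.SourcesStandard)
    (hb : M.SquareSummableB) {h : ℕ → lp (fun _ : ℕ => ℝ) 2} {h' : lp (fun _ : ℕ => ℝ) 2}
    (hlim : Tendsto h atTop (𝓝 h')) :
    ∃ φ : ℕ → ℕ, StrictMono φ ∧
      ∀ᵐ ω ∂P, Tendsto (fun n => M.gain hM hb (h (φ n)) ω) atTop (𝓝 (M.gain hM hb h' ω)) :=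
  (tendstoInMeasure_of_tendsto_Lp
    (((M.gain hM hb).continuous.tendsto h').comp hlim)).exists_seq_tendsto_ae

theorem convex_setOf_gain_ge (M : LargeMarket P) (hM : M.SourcesStandard)
    (hb : M.SquareSummableB) (G : Ω → ℝ) :
    Convex ℝ {h | ∀ᵐ ω ∂P, G ω ≤ M.gain hM hb h ω} := by
  intro g hg h hh s t hs ht hst
  simp only [Set.mem_ofPred_eq] at hg hh ⊢
  filter_upwards [M.coeFn_gain_combo hM hb g h s t, hg, hh] with ω h1 h2 h3
  rw [h1]
  calc G ω = s * G ω + t * G ω := by rw [← add_mul, hst, one_mul]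
    _ ≤ _ := add_le_add (mul_le_mul_of_nonneg_left h2 hs) (mul_le_mul_of_nonneg_left h3 ht)

theorem isClosed_setOf_gain_ge (M : LargeMarket P) (hM : M.SourcesStandard)
    (hb : M.SquareSummableB) (G : Ω → ℝ) :
    IsClosed {h | ∀ᵐ ω ∂P, G ω ≤ M.gain hM hb h ω} := by
  refine IsSeqClosed.isClosed fun h h' hmem hlim => ?_
  simp only [Set.mem_ofPred_eq] at hmem ⊢
  obtain ⟨φ, -, hφ⟩ := M.exists_subseq_tendsto_gain hM hb hlim
  filter_upwards [hφ, ae_all_iff.2 fun n => hmem (φ n)] with ω h1 h2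
  exact ge_of_tendsto' h1 h2

/-- Strategies whose losses are bounded by a given constant are bounded in `ℓ²`. -/
theorem exists_norm_le_of_gain_ge (M : LargeMarket P) (hM : M.SourcesStandard)
    (hb : M.SquareSummableB) (harb : M.NoArbitrage) (h3 : M.BoundedThirdMoments) (x : ℝ) :
    ∃ R : ℝ, ∀ h : lp (fun _ : ℕ => ℝ) 2, (∀ᵐ ω ∂P, -x ≤ M.gain hM hb h ω) → ‖h‖ ≤ R := by
  obtain ⟨c, hc, hkhin⟩ := M.exists_integral_abs_noiseSum_ge hM h3
  -- Unit norm is not preserved by weak limits. The half-space replaces it: it is convex and closed,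
  -- and it excludes `0`.
  set K : ℕ → Set (lp (fun _ : ℕ => ℝ) 2) := fun n =>
    (Metric.closedBall 0 1 ∩ {g | inner ℝ (M.bLp hb) g ≤ -(c / 4)}) ∩
      {g | ∀ᵐ ω ∂P, -(1 / ((n : ℝ) + 1)) ≤ M.gain hM hb g ω} with hK
  have hempty : ∃ n, ¬ (K n).Nonempty := by
    by_contra! hne
    obtain ⟨g, hg⟩ := iInter_nonempty_of_antitone_convex (K := K) (R := 1)
      (by
        rintro n k hnk g ⟨hg1, hg2⟩
        refine ⟨hg1, ?_⟩
        simp only [Set.mem_ofPred_eq] at hg2 ⊢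
        filter_upwards [hg2] with ω hω
        refine (neg_le_neg (one_div_le_one_div_of_le (by positivity) ?_)).trans hω
        exact_mod_cast Nat.succ_le_succ hnk)
      hne
      (fun n => (Metric.isClosed_closedBall.inter
        (isClosed_le (continuous_const.inner continuous_id) continuous_const)).inter
        (M.isClosed_setOf_gain_ge hM hb _))
      (fun n => ((convex_closedBall 0 1).inter
        (convex_halfSpace_le (innerSL ℝ (M.bLp hb)).isLinear _)).inter
        (M.convex_setOf_gain_ge hM hb _))
      (fun g hg => by simpa using hg.1.1)
    rw [Set.mem_iInter] at hg
    have hpos : ∀ᵐ ω ∂P, 0 ≤ M.gain hM hb g ω := by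
      filter_upwards [ae_all_iff.2 fun n => (hg n).2] with ω hω
      have h1 := tendsto_one_div_add_atTop_nhds_zero_nat (𝕜 := ℝ).neg
      rw [neg_zero] at h1
      exact le_of_tendsto' h1 hω
    have hg0 := M.eq_zero_of_gain_nonneg hM hb harb hpos
    have h2 : inner ℝ (M.bLp hb) g ≤ -(c / 4) := (hg 0).1.2
    rw [hg0, inner_zero_right] at h2
    linarith
  obtain ⟨n, hn⟩ := hempty
  -- The first bound puts the normalized strategy in the last set defining `K n`; the second leaves
  -- `c - 2δ ≥ c / 2` when the estimates `hupper` and `hlower` are compared, which forces `⟨b, g⟩ ≤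
  -- -c / 4`.
  set δ : ℝ := min (1 / ((n : ℝ) + 1)) (c / 4) with hδ
  have hδ0 : 0 < δ := lt_min (by positivity) (by positivity)
  refine ⟨|x| / δ, fun h hh => ?_⟩
  by_contra! hlt
  have hpos : 0 < ‖h‖ := lt_of_le_of_lt (by positivity) hlt
  set g := ‖h‖⁻¹ • h with hg
  have hgn : ‖g‖ = 1 := by
    rw [hg, norm_smul, norm_inv, norm_norm, inv_mul_cancel₀ hpos.ne']
  have hxδ : ‖h‖⁻¹ * |x| ≤ δ := by
    rw [inv_mul_le_iff₀ hpos, ← div_le_iff₀ hδ0]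
    exact hlt.le
  have hgain : ∀ᵐ ω ∂P, -δ ≤ M.gain hM hb g ω := by
    rw [hg, map_smul]
    filter_upwards [hh, Lp.coeFn_smul ‖h‖⁻¹ (M.gain hM hb h)] with ω h1 h2
    rw [h2, Pi.smul_apply, smul_eq_mul]
    have h4 : ‖h‖⁻¹ * (-|x|) ≤ ‖h‖⁻¹ * M.gain hM hb h ω :=
      mul_le_mul_of_nonneg_left (by linarith [le_abs_self x]) (by positivity)
    linarith
  have hint : ∀ f : Lp ℝ 2 P, Integrable f P := fun f => (Lp.memLp f).integrable (by norm_num)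
  -- For `t ≥ -δ` one has `|t| ≤ t + 2δ`.
  have hupper : ∫ ω, |M.gain hM hb g ω| ∂P ≤ -inner ℝ (M.bLp hb) g + 2 * δ := by
    have h1 : ∫ ω, |M.gain hM hb g ω| ∂P ≤ ∫ ω, (M.gain hM hb g ω + 2 * δ) ∂P := by
      refine integral_mono_ae (hint _).abs ((hint _).add (integrable_const _)) ?_
      filter_upwards [hgain] with ω hω
      rw [abs_le]
      constructor <;> linarith
    rw [integral_add (hint _) (integrable_const _), M.integral_gain] at h1
    simpa using h1
  have hlower : c - |inner ℝ (M.bLp hb) g| ≤ ∫ ω, |M.gain hM hb g ω| ∂P := by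
    have h1 : ∫ ω, |M.noiseSum hM g ω| ∂P
        ≤ ∫ ω, (|M.gain hM hb g ω| + |inner ℝ (M.bLp hb) g|) ∂P := by
      refine integral_mono_ae (hint _).abs ((hint _).abs.add (integrable_const _)) ?_
      rw [M.gain_apply]
      filter_upwards [Lp.coeFn_sub (M.noiseSum hM g)
        (Lp.constL 2 P ℝ (inner ℝ (M.bLp hb) g)),
        Lp.coeFn_const 2 P (inner ℝ (M.bLp hb) g)] with ω h1 h2
      rw [h1, Pi.sub_apply, Lp.constL_apply, h2, Function.const_apply]
      linarith [abs_sub_abs_le_abs_sub (M.noiseSum hM g ω) (inner ℝ (M.bLp hb) g)]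
    rw [integral_add (hint _).abs (integrable_const _)] at h1
    have h2 := hkhin g hgn
    simp only [integral_const, probReal_univ, one_smul] at h1
    linarith
  have hδ1 : δ ≤ c / 4 := min_le_right _ _
  refine hn ⟨g, ⟨by simp [hgn], ?_⟩, ?_⟩
  · rcases abs_cases (inner ℝ (M.bLp hb) g) with ⟨h1, -⟩ | ⟨h1, -⟩
    · linarith
    · simp only [Set.mem_ofPred_eq]
      linarith
  · simp only [Set.mem_ofPred_eq]
    filter_upwards [hgain] with ω hω
    exact (neg_le_neg (min_le_left _ _)).trans hω

end LargeMarket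
end

/-! ### Utility as an affine function minus a convex gap -/

noncomputable section

section Utility

theorem ConcaveOn.le_tangent_Ioi {U : ℝ → ℝ} (hU : ConcaveOn ℝ (Set.Ioi 0) U)
    (hd : DifferentiableOn ℝ U (Set.Ioi 0)) {a y : ℝ} (ha : 0 < a) (hy : 0 < y) :
    U y ≤ U a + deriv U a * (y - a) := by
  have hda : DifferentiableAt ℝ U a := (hd a ha).differentiableAt (Ioi_mem_nhds ha)
  rcases lt_trichotomy a y with h | rfl | h
  · have := hU.slope_le_deriv ha hy h hda
    rw [slope_def_field, div_le_iff₀ (sub_pos.2 h)] at this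
    linarith
  · simp
  · have := hU.deriv_le_slope hy ha h hda
    rw [slope_def_field, le_div_iff₀ (sub_pos.2 h)] at this
    linarith

/-- An affine majorant of the concave function `U`, nonnegative on `[0, ∞[`. -/
def affineMajorant (U : ℝ → ℝ) (y : ℝ) : ℝ := |U 1| + deriv U 1 * y

/-- The supremum of the gaps between the affine majorant and the tangents of `U`. -/
def tangentGap (U : ℝ → ℝ) (y : ℝ) : ℝ≥0∞ :=
  ⨆ a : Set.Ioi (0 : ℝ), ENNReal.ofReal (affineMajorant U y - (U a + deriv U a * (y - a)))

theorem continuous_affineMajorant (U : ℝ → ℝ) : Continuous (affineMajorant U) := by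
  unfold affineMajorant
  fun_prop

theorem affineMajorant_combo (U : ℝ → ℝ) {s t : ℝ} (hst : s + t = 1) (y z : ℝ) :
    affineMajorant U (s * y + t * z) = s * affineMajorant U y + t * affineMajorant U z := by
  unfold affineMajorant
  linear_combination -|U 1| * hst

theorem lowerSemicontinuous_tangentGap (U : ℝ → ℝ) : LowerSemicontinuous (tangentGap U) :=
  lowerSemicontinuous_iSup fun a => Continuous.lowerSemicontinuous
    (ENNReal.continuous_ofReal.comp
      ((continuous_affineMajorant U).sub (by fun_prop)))

theorem tangentGap_combo_le (U : ℝ → ℝ) {s t : ℝ} (hs : 0 ≤ s) (ht : 0 ≤ t) (hst : s + t = 1)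
    (y z : ℝ) :
    tangentGap U (s * y + t * z)
      ≤ ENNReal.ofReal s * tangentGap U y + ENNReal.ofReal t * tangentGap U z := by
  refine iSup_le fun a => ?_
  have h1 : affineMajorant U (s * y + t * z) - (U a + deriv U a * (s * y + t * z - a))
      = s * (affineMajorant U y - (U a + deriv U a * (y - a)))
        + t * (affineMajorant U z - (U a + deriv U a * (z - a))) := by
    rw [affineMajorant_combo U hst]
    linear_combination (U a - deriv U a * a) * hst
  rw [h1]
  refine ENNReal.ofReal_add_le.trans ?_
  rw [ENNReal.ofReal_mul hs, ENNReal.ofReal_mul ht]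
  gcongr
  · exact le_iSup (fun a : Set.Ioi (0 : ℝ) =>
      ENNReal.ofReal (affineMajorant U y - (U a + deriv U a * (y - a)))) a
  · exact le_iSup (fun a : Set.Ioi (0 : ℝ) =>
      ENNReal.ofReal (affineMajorant U z - (U a + deriv U a * (z - a)))) a

variable {U : ℝ → ℝ}

theorem deriv_nonneg_of_monotoneOn_Ioi (hm : MonotoneOn U (Set.Ioi 0)) {a : ℝ} (ha : 0 < a) :
    0 ≤ deriv U a := by
  rw [← derivWithin_of_isOpen isOpen_Ioi ha]
  exact hm.derivWithin_nonneg

theorem affineMajorant_nonneg (hm : MonotoneOn U (Set.Ioi 0)) {y : ℝ} (hy : 0 ≤ y) :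
    0 ≤ affineMajorant U y :=
  add_nonneg (abs_nonneg _) (mul_nonneg (deriv_nonneg_of_monotoneOn_Ioi hm one_pos) hy)

theorem le_affineMajorant (hU : ConcaveOn ℝ (Set.Ioi 0) U) (hm : MonotoneOn U (Set.Ioi 0))
    (hd : DifferentiableOn ℝ U (Set.Ioi 0)) {y : ℝ} (hy : 0 < y) : U y ≤ affineMajorant U y := by
  have h1 := hU.le_tangent_Ioi hd one_pos hy
  have h2 := deriv_nonneg_of_monotoneOn_Ioi hm one_pos
  have h3 := le_abs_self (U 1)
  unfold affineMajorant
  linarith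

theorem tendsto_extendUtility_zero (hm : MonotoneOn U (Set.Ioi 0)) :
    Tendsto (fun z : ℝ => (U z : EReal)) (𝓝[>] 0) (𝓝 (extendUtility U 0)) := by
  have h1 : MonotoneOn (fun z : ℝ => (U z : EReal)) (Set.Ioi 0) :=
    fun a ha b hb hab => EReal.coe_le_coe_iff.2 (hm ha hb hab)
  have h2 := h1.tendsto_nhdsGT (OrderBot.bddBelow _)
  have h3 : extendUtility U 0 = sInf ((fun z : ℝ => (U z : EReal)) '' Set.Ioi 0) := by
    simp only [extendUtility, lt_irrefl, if_false, if_true]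
    exact rightLim_eq_of_tendsto h2
  rwa [h3]

theorem extendUtility_le_affineMajorant (hU : ConcaveOn ℝ (Set.Ioi 0) U)
    (hm : MonotoneOn U (Set.Ioi 0)) (hd : DifferentiableOn ℝ U (Set.Ioi 0)) {y : ℝ}
    (hy : 0 ≤ y) : extendUtility U y ≤ affineMajorant U y := by
  rcases hy.eq_or_lt with rfl | hy
  · have h1 : Tendsto (fun z => (affineMajorant U z : EReal)) (𝓝[>] 0)
        (𝓝 (affineMajorant U 0 : EReal)) :=
      (continuous_coe_real_ereal.comp (continuous_affineMajorant U)).continuousWithinAt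
    refine le_of_tendsto_of_tendsto (tendsto_extendUtility_zero hm) h1 ?_
    filter_upwards [self_mem_nhdsWithin] with z hz
    exact EReal.coe_le_coe_iff.2 (le_affineMajorant hU hm hd hz)
  · rw [extendUtility, if_pos hy]
    exact EReal.coe_le_coe_iff.2 (le_affineMajorant hU hm hd hy)

/-- A concave function is the infimum of its tangents. At `y = 0` the tangent at `z` takes the value
`U z - U' z * z ≤ U z`, and `z ↓ 0` recovers the right limit, even when it is `-∞`. -/
theorem tangentGap_eq (hU : ConcaveOn ℝ (Set.Ioi 0) U)
    (hm : MonotoneOn U (Set.Ioi 0)) (hd : DifferentiableOn ℝ U (Set.Ioi 0)) {y : ℝ}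
    (hy : 0 ≤ y) :
    tangentGap U y = ((affineMajorant U y : EReal) - extendUtility U y).toENNReal := by
  rcases hy.eq_or_lt with rfl | hy
  · have h1 : Tendsto (fun z : ℝ => ENNReal.ofReal (affineMajorant U 0 - U z)) (𝓝[>] 0)
        (𝓝 ((affineMajorant U 0 : EReal) - extendUtility U 0).toENNReal) := by
      have h2 : ContinuousAt (fun p : EReal × EReal => p.1 + p.2)
          ((affineMajorant U 0 : EReal), -extendUtility U 0) :=
        EReal.continuousAt_add (Or.inl (EReal.coe_ne_top _)) (Or.inl (EReal.coe_ne_bot _))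
      have h3 := h2.tendsto.comp (tendsto_const_nhds.prodMk_nhds
        ((continuous_neg.tendsto _).comp (tendsto_extendUtility_zero hm)))
      exact (EReal.continuous_toENNReal.tendsto _).comp h3
    refine le_antisymm (iSup_le fun ⟨a, ha⟩ => ?_) (le_of_tendsto h1 ?_)
    · have h4 : Tendsto (fun z : ℝ => ENNReal.ofReal
          (affineMajorant U 0 - (U a + deriv U a * (z - a)))) (𝓝[>] 0)
          (𝓝 (ENNReal.ofReal (affineMajorant U 0 - (U a + deriv U a * (0 - a))))) := by
        refine Continuous.continuousWithinAt ?_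
        exact ENNReal.continuous_ofReal.comp (by fun_prop)
      refine le_of_tendsto_of_tendsto h4 h1 ?_
      filter_upwards [self_mem_nhdsWithin] with z hz
      exact ENNReal.ofReal_le_ofReal (sub_le_sub_left (hU.le_tangent_Ioi hd ha hz) _)
    · filter_upwards [self_mem_nhdsWithin] with z hz
      refine le_iSup_of_le (⟨z, hz⟩ : Set.Ioi (0 : ℝ)) (ENNReal.ofReal_le_ofReal ?_)
      have := mul_nonneg (deriv_nonneg_of_monotoneOn_Ioi hm hz) (le_of_lt hz)
      simp only
      linarith
  · rw [extendUtility, if_pos hy, ← EReal.coe_sub, EReal.real_coe_toENNReal]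
    refine le_antisymm (iSup_le fun ⟨a, ha⟩ => ENNReal.ofReal_le_ofReal
      (sub_le_sub_left (hU.le_tangent_Ioi hd ha hy) _)) ?_
    exact le_iSup_of_le (⟨y, hy⟩ : Set.Ioi (0 : ℝ)) (by simp)

theorem EReal.toENNReal_sub_add_toENNReal {X : EReal} {z : ℝ} (hz : 0 ≤ z) (hX : X ≤ z) :
    ((z : EReal) - X).toENNReal + X.toENNReal = (-X).toENNReal + ENNReal.ofReal z := by
  induction X with
  | bot => simp
  | top => simp at hX
  | coe r =>
    rw [EReal.coe_le_coe_iff] at hX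
    rw [← EReal.coe_sub, ← EReal.coe_neg]
    simp only [EReal.real_coe_toENNReal]
    rcases le_total 0 r with h | h
    · rw [ENNReal.ofReal_of_nonpos (neg_nonpos.2 h), zero_add,
        ← ENNReal.ofReal_add (_root_.sub_nonneg.2 hX) h, _root_.sub_add_cancel]
    · rw [ENNReal.ofReal_of_nonpos h, add_zero, ← ENNReal.ofReal_add (neg_nonneg.2 h) hz]
      congr 1
      ring

/-- Formally `p - n = z - g`; if `n = ∞` then `g = ∞` and both sides fail. The condition `c ≤ z` is
needed because `ENNReal.ofReal` truncates negative numbers to `0`. -/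
theorem EReal.coe_le_sub_iff_of_add_eq_add {p n g : ℝ≥0∞} {z c : ℝ} (hp : p ≠ ∞) (hz : 0 ≤ z)
    (h : g + p = n + ENNReal.ofReal z) :
    (c : EReal) ≤ (p : EReal) - (n : EReal) ↔ c ≤ z ∧ g ≤ ENNReal.ofReal (z - c) := by
  lift p to NNReal using hp
  rcases eq_or_ne n ∞ with rfl | hn
  · have hg : g = ∞ := by
      rw [top_add, ENNReal.add_eq_top] at h
      exact h.resolve_right ENNReal.coe_ne_top
    subst hg
    simp
  · lift n to NNReal using hn
    have hg : g ≠ ∞ := by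
      rintro rfl
      rw [top_add] at h
      exact ENNReal.add_ne_top.2 ⟨ENNReal.coe_ne_top, ENNReal.ofReal_ne_top⟩ h.symm
    lift g to NNReal using hg
    have h1 : (g : ℝ) + p = n + z := by
      have := congrArg ENNReal.toReal h
      rwa [ENNReal.toReal_add ENNReal.coe_ne_top ENNReal.coe_ne_top,
        ENNReal.toReal_add ENNReal.coe_ne_top ENNReal.ofReal_ne_top,
        ENNReal.toReal_ofReal hz] at this
    have h2 : ((p : ℝ≥0∞) : EReal) - ((n : ℝ≥0∞) : EReal) = ((p - n : ℝ) : EReal) := rfl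
    rw [h2, EReal.coe_le_coe_iff]
    constructor
    · intro h3
      have h4 := g.2
      refine ⟨by simp only [NNReal.val_eq_coe] at h4; linarith, ?_⟩
      rw [← ENNReal.ofReal_coe_nnreal]
      exact ENNReal.ofReal_le_ofReal (by linarith)
    · rintro ⟨h3, h4⟩
      rw [← ENNReal.ofReal_coe_nnreal, ENNReal.ofReal_le_ofReal_iff (by linarith)] at h4
      linarith

variable {Ω : Type*} [MeasurableSpace Ω] {P : Measure Ω} [IsProbabilityMeasure P]

theorem integrable_affineMajorant {Y : Ω → ℝ} (hY : Integrable Y P) :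
    Integrable (fun ω => affineMajorant U (Y ω)) P :=
  (integrable_const _).add (hY.const_mul _)

theorem posExpectation_extendUtility_le (hU : ConcaveOn ℝ (Set.Ioi 0) U)
    (hm : MonotoneOn U (Set.Ioi 0)) (hd : DifferentiableOn ℝ U (Set.Ioi 0)) {Y : Ω → ℝ}
    (hY : Integrable Y P) (hY0 : ∀ᵐ ω ∂P, 0 ≤ Y ω) :
    posExpectation P (fun ω => extendUtility U (Y ω)) < ∞ := by
  refine lt_of_le_of_lt (lintegral_mono_ae ?_)
    (integrable_affineMajorant (U := U) hY).lintegral_lt_top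
  filter_upwards [hY0] with ω h0
  exact EReal.toENNReal_le_toENNReal (extendUtility_le_affineMajorant hU hm hd h0)

/-- Lower bounds for the expected utility in terms of the convex functional
`Y ↦ E (tangentGap U Y)`. -/
theorem coe_le_extExpectation_extendUtility_iff (hU : ConcaveOn ℝ (Set.Ioi 0) U)
    (hm : MonotoneOn U (Set.Ioi 0)) (hd : DifferentiableOn ℝ U (Set.Ioi 0)) {Y : Ω → ℝ}
    (hY : Integrable Y P) (hY0 : ∀ᵐ ω ∂P, 0 ≤ Y ω) (c : ℝ) :
    (c : EReal) ≤ extExpectation P (fun ω => extendUtility U (Y ω)) ↔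
      c ≤ ∫ ω, affineMajorant U (Y ω) ∂P ∧
      ∫⁻ ω, tangentGap U (Y ω) ∂P ≤ ENNReal.ofReal (∫ ω, affineMajorant U (Y ω) ∂P - c) := by
  have hint := integrable_affineMajorant (U := U) hY
  have hnn : 0 ≤ᵐ[P] fun ω => affineMajorant U (Y ω) := by
    filter_upwards [hY0] with ω h0
    exact affineMajorant_nonneg hm h0
  refine EReal.coe_le_sub_iff_of_add_eq_add
    (posExpectation_extendUtility_le hU hm hd hY hY0).ne (integral_nonneg_of_ae hnn) ?_
  have hgap : AEMeasurable (fun ω => tangentGap U (Y ω)) P :=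
    (lowerSemicontinuous_tangentGap U).measurable.comp_aemeasurable hY.1.aemeasurable
  rw [ofReal_integral_eq_lintegral_ofReal hint hnn, posExpectation, posExpectation,
    ← lintegral_add_left' hgap, ← lintegral_add_right' _ hint.1.aemeasurable.ennreal_ofReal]
  refine lintegral_congr_ae ?_
  filter_upwards [hY0] with ω h0
  rw [tangentGap_eq hU hm hd h0]
  exact EReal.toENNReal_sub_add_toENNReal (affineMajorant_nonneg hm h0)
    (extendUtility_le_affineMajorant hU hm hd h0)

end Utility
end

/-! ### Superhedging sets and level sets of the expected utility -/

noncomputable section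

section Expectation

variable {Ω : Type*} [MeasurableSpace Ω] {P : Measure Ω}

theorem posExpectation_congr {X Y : Ω → EReal} (h : X =ᵐ[P] Y) :
    posExpectation P X = posExpectation P Y := by
  refine lintegral_congr_ae ?_
  filter_upwards [h] with ω hω
  rw [hω]

theorem extExpectation_congr {X Y : Ω → EReal} (h : X =ᵐ[P] Y) :
    extExpectation P X = extExpectation P Y := by
  rw [extExpectation, extExpectation, posExpectation_congr h,
    posExpectation_congr (X := fun ω => -X ω) (Y := fun ω => -Y ω)
      (h.mono fun ω hω => by simp only [hω])]

end Expectation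

namespace LargeMarket

variable {Ω : Type*} [MeasurableSpace Ω] {P : Measure Ω} [IsProbabilityMeasure P]
  {U : ℝ → ℝ} {G : Ω → ℝ}

theorem superhedges_eq (M : LargeMarket P) (hM : M.SourcesStandard) (hb : M.SquareSummableB)
    (G : Ω → ℝ) (x : ℝ) :
    M.superhedges G x = {h | ∀ᵐ ω ∂P, G ω - x ≤ M.gain hM hb h ω} := by
  ext h
  simp only [superhedges, Set.mem_ofPred_eq]
  constructor
  · intro hh
    filter_upwards [hh, M.coeFn_value hM hb x h] with ω h1 h2
    linarith
  · intro hh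
    filter_upwards [hh, M.coeFn_value hM hb x h] with ω h1 h2
    linarith

theorem isClosed_superhedges (M : LargeMarket P) (hM : M.SourcesStandard)
    (hb : M.SquareSummableB) (G : Ω → ℝ) (x : ℝ) : IsClosed (M.superhedges G x) := by
  rw [M.superhedges_eq hM hb]
  exact M.isClosed_setOf_gain_ge hM hb _

theorem convex_superhedges (M : LargeMarket P) (hM : M.SourcesStandard)
    (hb : M.SquareSummableB) (G : Ω → ℝ) (x : ℝ) : Convex ℝ (M.superhedges G x) := by
  rw [M.superhedges_eq hM hb]
  exact M.convex_setOf_gain_ge hM hb _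

theorem superhedges_mono (M : LargeMarket P) (hM : M.SourcesStandard)
    (hb : M.SquareSummableB) (G : Ω → ℝ) : Monotone (M.superhedges G) := by
  intro x y hxy h hh
  rw [M.superhedges_eq hM hb, Set.mem_ofPred_eq] at hh ⊢
  filter_upwards [hh] with ω h1
  linarith

theorem exists_norm_le_of_mem_superhedges (M : LargeMarket P) (hM : M.SourcesStandard)
    (hb : M.SquareSummableB) (harb : M.NoArbitrage) (h3 : M.BoundedThirdMoments)
    (hG0 : ∀ᵐ ω ∂P, 0 ≤ G ω) (x : ℝ) : ∃ R, ∀ h ∈ M.superhedges G x, ‖h‖ ≤ R := by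
  obtain ⟨R, hR⟩ := M.exists_norm_le_of_gain_ge hM hb harb h3 x
  refine ⟨R, fun h hh => hR h ?_⟩
  rw [M.superhedges_eq hM hb, Set.mem_ofPred_eq] at hh
  filter_upwards [hh, hG0] with ω h1 h2
  linarith

/-- The infimum defining the superreplication price is attained. -/
theorem superhedges_nonempty (M : LargeMarket P) (hM : M.SourcesStandard)
    (hb : M.SquareSummableB) (harb : M.NoArbitrage) (h3 : M.BoundedThirdMoments)
    (hG0 : ∀ᵐ ω ∂P, 0 ≤ G ω) {x : ℝ} (hx : M.superPrice G ≤ (x : EReal)) :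
    (M.superhedges G x).Nonempty := by
  -- The wealth `x + 1` is that of the largest set in the sequence with wealths `x + 1 / (n + 1)`.
  obtain ⟨R, hR⟩ := M.exists_norm_le_of_mem_superhedges hM hb harb h3 hG0 (x + 1 / ((0 : ℕ) + 1))
  obtain ⟨h, hh⟩ := iInter_nonempty_of_antitone_convex
    (K := fun n : ℕ => M.superhedges G (x + 1 / ((n : ℝ) + 1)))
    (fun n k hnk => M.superhedges_mono hM hb G (by gcongr))
    (fun n => by
      have h1 : M.superPrice G < ((x + 1 / ((n : ℝ) + 1) : ℝ) : EReal) :=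
        hx.trans_lt (EReal.coe_lt_coe_iff.2 (by linarith [Nat.one_div_pos_of_nat (α := ℝ) (n := n)]))
      obtain ⟨_, ⟨z, rfl, hz⟩, hlt⟩ := sInf_lt_iff.1 h1
      exact hz.mono (M.superhedges_mono hM hb G (EReal.coe_lt_coe_iff.1 hlt).le))
    (fun n => M.isClosed_superhedges hM hb G _) (fun n => M.convex_superhedges hM hb G _)
    (by exact_mod_cast hR)
  refine ⟨h, ?_⟩
  rw [Set.mem_iInter] at hh
  simp only [M.superhedges_eq hM hb, Set.mem_ofPred_eq] at hh ⊢
  filter_upwards [ae_all_iff.2 hh] with ω hω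
  have h1 := (tendsto_one_div_add_atTop_nhds_zero_nat (𝕜 := ℝ)).const_add x
  rw [add_zero] at h1
  exact le_of_tendsto' (h1.const_sub (G ω)) hω

theorem terminalUtility_ae_eq (M : LargeMarket P) (hM : M.SourcesStandard)
    (hb : M.SquareSummableB) (U : ℝ → ℝ) (G : Ω → ℝ) (x : ℝ) (h : lp (fun _ : ℕ => ℝ) 2) :
    M.terminalUtility U G x h =ᵐ[P]
      fun ω => extendUtility U (x + M.gain hM hb h ω - G ω) := by
  filter_upwards [M.coeFn_value hM hb x h] with ω hω
  rw [terminalUtility, hω]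

theorem integrable_gain (M : LargeMarket P) (hM : M.SourcesStandard) (hb : M.SquareSummableB)
    (h : lp (fun _ : ℕ => ℝ) 2) : Integrable (M.gain hM hb h) P :=
  (Lp.memLp _).integrable (by norm_num)

theorem integrable_of_mem_superhedges (M : LargeMarket P) (hM : M.SourcesStandard)
    (hb : M.SquareSummableB) (hG : AEMeasurable G P) (hG0 : ∀ᵐ ω ∂P, 0 ≤ G ω) {x : ℝ}
    {h : lp (fun _ : ℕ => ℝ) 2} (hh : h ∈ M.superhedges G x) : Integrable G P := by
  refine Integrable.mono' ((integrable_const x).add (M.integrable_gain hM hb h))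
    hG.aestronglyMeasurable ?_
  rw [M.superhedges_eq hM hb, Set.mem_ofPred_eq] at hh
  filter_upwards [hh, hG0] with ω h1 h2
  rw [Real.norm_of_nonneg h2, Pi.add_apply]
  linarith

/-- `0 ≤ G ≤ V` makes `G` integrable, and the positive part of the utility is dominated by the
affine majorant of `V - G`. -/
theorem mem_admissible_iff (M : LargeMarket P) (hM : M.SourcesStandard)
    (hb : M.SquareSummableB) (hU : ConcaveOn ℝ (Set.Ioi 0) U) (hm : MonotoneOn U (Set.Ioi 0))
    (hd : DifferentiableOn ℝ U (Set.Ioi 0)) (hG : AEMeasurable G P) (hG0 : ∀ᵐ ω ∂P, 0 ≤ G ω)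
    {x : ℝ} {h : lp (fun _ : ℕ => ℝ) 2} :
    h ∈ M.admissible U G x ↔ h ∈ M.superhedges G x := by
  refine ⟨fun hh => hh.2, fun hh => ⟨?_, hh⟩⟩
  have hGi := M.integrable_of_mem_superhedges hM hb hG hG0 hh
  rw [Set.mem_ofPred_eq, posExpectation_congr (M.terminalUtility_ae_eq hM hb U G x h)]
  refine posExpectation_extendUtility_le hU hm hd
    (((integrable_const x).add (M.integrable_gain hM hb h)).sub hGi) ?_
  rw [M.superhedges_eq hM hb, Set.mem_ofPred_eq] at hh
  filter_upwards [hh] with ω h1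
  linarith

/-- The upper level sets of the expected utility. -/
def utilityLevelSet (M : LargeMarket P) (U : ℝ → ℝ) (G : Ω → ℝ) (x c : ℝ) :
    Set (lp (fun _ : ℕ => ℝ) 2) :=
  {h | h ∈ M.superhedges G x ∧ (c : EReal) ≤ extExpectation P (M.terminalUtility U G x h)}

/-- The expectation of the affine majorant depends on `h` only through the mean gain `-⟨b, h⟩`. In
this form convexity and closedness can be read off. -/
theorem mem_utilityLevelSet_iff (M : LargeMarket P) (hM : M.SourcesStandard)
    (hb : M.SquareSummableB) (hU : ConcaveOn ℝ (Set.Ioi 0) U) (hm : MonotoneOn U (Set.Ioi 0))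
    (hd : DifferentiableOn ℝ U (Set.Ioi 0)) (hG : AEMeasurable G P) (hG0 : ∀ᵐ ω ∂P, 0 ≤ G ω)
    {x c : ℝ} {h : lp (fun _ : ℕ => ℝ) 2} :
    h ∈ M.utilityLevelSet U G x c ↔ h ∈ M.superhedges G x ∧
      c ≤ affineMajorant U (x - inner ℝ (M.bLp hb) h - ∫ ω, G ω ∂P) ∧
      ∫⁻ ω, tangentGap U (x + M.gain hM hb h ω - G ω) ∂P ≤ ENNReal.ofReal
        (affineMajorant U (x - inner ℝ (M.bLp hb) h - ∫ ω, G ω ∂P) - c) := by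
  refine and_congr_right fun hh => ?_
  have hGi := M.integrable_of_mem_superhedges hM hb hG hG0 hh
  have hV : Integrable (fun ω => x + M.gain hM hb h ω) P :=
    (integrable_const x).add (M.integrable_gain hM hb h)
  have hY : Integrable (fun ω => x + M.gain hM hb h ω - G ω) P := hV.sub hGi
  have hint : ∫ ω, affineMajorant U (x + M.gain hM hb h ω - G ω) ∂P
      = affineMajorant U (x - inner ℝ (M.bLp hb) h - ∫ ω, G ω ∂P) := by
    simp only [affineMajorant]
    rw [integral_add (integrable_const _) (hY.const_mul _), integral_const_mul,
      integral_sub hV hGi, integral_add (integrable_const _) (M.integrable_gain hM hb h),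
      M.integral_gain]
    simp [sub_eq_add_neg]
  rw [extExpectation_congr (M.terminalUtility_ae_eq hM hb U G x h),
    coe_le_extExpectation_extendUtility_iff hU hm hd hY ?_, hint]
  rw [M.superhedges_eq hM hb, Set.mem_ofPred_eq] at hh
  filter_upwards [hh] with ω h1
  linarith

theorem convex_utilityLevelSet (M : LargeMarket P) (hM : M.SourcesStandard)
    (hb : M.SquareSummableB) (hU : ConcaveOn ℝ (Set.Ioi 0) U) (hm : MonotoneOn U (Set.Ioi 0))
    (hd : DifferentiableOn ℝ U (Set.Ioi 0)) (hG : AEMeasurable G P) (hG0 : ∀ᵐ ω ∂P, 0 ≤ G ω)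
    (x c : ℝ) : Convex ℝ (M.utilityLevelSet U G x c) := by
  intro g hg h hh s t hs ht hst
  rw [M.mem_utilityLevelSet_iff hM hb hU hm hd hG hG0] at hg hh ⊢
  obtain ⟨hg1, hg2, hg3⟩ := hg
  obtain ⟨hh1, hh2, hh3⟩ := hh
  have haff : affineMajorant U (x - inner ℝ (M.bLp hb) (s • g + t • h) - ∫ ω, G ω ∂P)
      = s * affineMajorant U (x - inner ℝ (M.bLp hb) g - ∫ ω, G ω ∂P)
        + t * affineMajorant U (x - inner ℝ (M.bLp hb) h - ∫ ω, G ω ∂P) := by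
    rw [← affineMajorant_combo U hst, inner_add_right, real_inner_smul_right,
      real_inner_smul_right]
    congr 1
    linear_combination ((∫ ω, G ω ∂P) - x) * hst
  have hc : c = s * c + t * c := by rw [← add_mul, hst, one_mul]
  refine ⟨M.convex_superhedges hM hb G x hg1 hh1 hs ht hst, ?_, ?_⟩
  · rw [haff, hc]
    gcongr
  have hmeas : ∀ k, AEMeasurable
      (fun ω => tangentGap U (x + M.gain hM hb k ω - G ω)) P := fun k =>
    (lowerSemicontinuous_tangentGap U).measurable.comp_aemeasurable
      (((M.integrable_gain hM hb k).1.aemeasurable.const_add x).sub hG)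
  have hle : ∫⁻ ω, tangentGap U (x + M.gain hM hb (s • g + t • h) ω - G ω) ∂P
      ≤ ∫⁻ ω, (ENNReal.ofReal s * tangentGap U (x + M.gain hM hb g ω - G ω)
        + ENNReal.ofReal t * tangentGap U (x + M.gain hM hb h ω - G ω)) ∂P := by
    refine lintegral_mono_ae ?_
    filter_upwards [M.coeFn_gain_combo hM hb g h s t] with ω hω
    refine le_trans (le_of_eq ?_) (tangentGap_combo_le U hs ht hst _ _)
    congr 1
    rw [hω]
    linear_combination (G ω - x) * hst
  refine hle.trans ?_
  rw [lintegral_add_left' ((hmeas g).const_mul _), lintegral_const_mul'' _ (hmeas g),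
    lintegral_const_mul'' _ (hmeas h)]
  refine (add_le_add (mul_le_mul_right hg3 _) (mul_le_mul_right hh3 _)).trans (le_of_eq ?_)
  rw [← ENNReal.ofReal_mul hs, ← ENNReal.ofReal_mul ht,
    ← ENNReal.ofReal_add (mul_nonneg hs (sub_nonneg.2 hg2)) (mul_nonneg ht (sub_nonneg.2 hh2)),
    haff]
  congr 1
  linear_combination hc

theorem isClosed_utilityLevelSet (M : LargeMarket P) (hM : M.SourcesStandard)
    (hb : M.SquareSummableB) (hU : ConcaveOn ℝ (Set.Ioi 0) U) (hm : MonotoneOn U (Set.Ioi 0))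
    (hd : DifferentiableOn ℝ U (Set.Ioi 0)) (hG : AEMeasurable G P) (hG0 : ∀ᵐ ω ∂P, 0 ≤ G ω)
    (x c : ℝ) : IsClosed (M.utilityLevelSet U G x c) := by
  refine IsSeqClosed.isClosed fun h h' hmem hlim => ?_
  simp only [M.mem_utilityLevelSet_iff hM hb hU hm hd hG hG0] at hmem ⊢
  have hcont : Continuous fun h : lp (fun _ : ℕ => ℝ) 2 =>
      affineMajorant U (x - inner ℝ (M.bLp hb) h - ∫ ω, G ω ∂P) :=
    (continuous_affineMajorant U).comp
      ((continuous_const.sub (continuous_const.inner continuous_id)).sub continuous_const)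
  have hlim2 := (hcont.tendsto h').comp hlim
  refine ⟨(M.isClosed_superhedges hM hb G x).mem_of_tendsto hlim
    (Eventually.of_forall fun n => (hmem n).1), ge_of_tendsto' hlim2 fun n => (hmem n).2.1, ?_⟩
  -- Fatou's lemma needs almost sure convergence; the right-hand side converges along the whole
  -- sequence, so a subsequence suffices.
  obtain ⟨φ, hφmono, hφ⟩ := M.exists_subseq_tendsto_gain hM hb hlim
  have hmeas : ∀ k, AEMeasurable
      (fun ω => tangentGap U (x + M.gain hM hb k ω - G ω)) P := fun k =>
    (lowerSemicontinuous_tangentGap U).measurable.comp_aemeasurable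
      (((M.integrable_gain hM hb k).1.aemeasurable.const_add x).sub hG)
  calc ∫⁻ ω, tangentGap U (x + M.gain hM hb h' ω - G ω) ∂P
      ≤ ∫⁻ ω, liminf (fun n => tangentGap U (x + M.gain hM hb (h (φ n)) ω - G ω)) atTop ∂P := by
        refine lintegral_mono_ae ?_
        filter_upwards [hφ] with ω hω
        exact (LowerSemicontinuousAt.le_liminf (lowerSemicontinuous_tangentGap U _)).trans
          (liminf_le_liminf_of_le ((hω.const_add x).sub_const (G ω)))
    _ ≤ liminf (fun n => ∫⁻ ω, tangentGap U (x + M.gain hM hb (h (φ n)) ω - G ω) ∂P) atTop :=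
        lintegral_liminf_le' fun n => hmeas _
    _ ≤ liminf (fun n => ENNReal.ofReal
          (affineMajorant U (x - inner ℝ (M.bLp hb) (h (φ n)) - ∫ ω, G ω ∂P) - c)) atTop :=
        liminf_le_liminf (Eventually.of_forall fun n => (hmem (φ n)).2.2)
    _ = _ := ((ENNReal.continuous_ofReal.tendsto _).comp
        ((hlim2.comp hφmono.tendsto_atTop).sub_const c)).liminf_eq

end LargeMarket
end

/-! ### Existence of an optimal strategy -/

theorem theorem2 {Ω : Type*} [MeasurableSpace Ω] (P : Measure Ω) [IsProbabilityMeasure P]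
    (M : LargeMarket P) (h_sources : M.SourcesStandard) (h_b : M.SquareSummableB)
    (h_arb : M.NoArbitrage) (h_third : M.BoundedThirdMoments)
    (U : ℝ → ℝ) (hU_concave : ConcaveOn ℝ (Set.Ioi 0) U)
    (hU_mono : StrictMonoOn U (Set.Ioi 0)) (hU_diff : DifferentiableOn ℝ U (Set.Ioi 0))
    (G : Ω → ℝ) (hG : AEMeasurable G P) (hG_nonneg : ∀ᵐ ω ∂P, 0 ≤ G ω)
    (x : ℝ) (hx : M.superPrice G ≤ (x : EReal)) :
    ∃ h ∈ M.admissible U G x,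
      M.maxUtility U G x = extExpectation P (M.terminalUtility U G x h) := by
  have hm := hU_mono.monotoneOn
  have hadm := fun h => M.mem_admissible_iff h_sources h_b hU_concave hm hU_diff hG hG_nonneg
    (x := x) (h := h)
  suffices H : ∃ h ∈ M.admissible U G x,
      M.maxUtility U G x ≤ extExpectation P (M.terminalUtility U G x h) by
    obtain ⟨h, hh, hle⟩ := H
    exact ⟨h, hh, hle.antisymm (le_iSup₂_of_le h hh le_rfl)⟩
  -- If the supremum is `-∞`, any superhedging strategy is optimal, and one exists because the
  -- superreplication price is attained.
  rcases eq_or_ne (M.maxUtility U G x) ⊥ with hbot | hbot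
  · obtain ⟨h, hh⟩ := M.superhedges_nonempty h_sources h_b h_arb h_third hG_nonneg hx
    exact ⟨h, (hadm h).2 hh, hbot ▸ bot_le⟩
  -- The levels lie strictly between `-∞` and the supremum, hence are finite; no prior bound on the
  -- supremum is required.
  obtain ⟨v, hvmono, hvmem, hvlim⟩ := exists_seq_strictMono_tendsto' (bot_lt_iff_ne_bot.2 hbot)
  have hv : ∀ n, ((v n).toReal : EReal) = v n := fun n =>
    EReal.coe_toReal (ne_top_of_lt (hvmem n).2) (hvmem n).1.ne'
  obtain ⟨R, hR⟩ := M.exists_norm_le_of_mem_superhedges h_sources h_b h_arb h_third hG_nonneg x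
  obtain ⟨h, hh⟩ := iInter_nonempty_of_antitone_convex
    (K := fun n => M.utilityLevelSet U G x (v n).toReal)
    (fun n k hnk h hh => ⟨hh.1, by
      rw [hv]
      refine (hvmono.monotone hnk).trans ?_
      rw [← hv k]
      exact hh.2⟩)
    (fun n => by
      obtain ⟨h, hh⟩ := lt_iSup_iff.1 (hvmem n).2
      obtain ⟨hh', hlt⟩ := lt_iSup_iff.1 hh
      exact ⟨h, hh'.2, by rw [hv]; exact hlt.le⟩)
    (fun n => M.isClosed_utilityLevelSet h_sources h_b hU_concave hm hU_diff hG hG_nonneg _ _)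
    (fun n => M.convex_utilityLevelSet h_sources h_b hU_concave hm hU_diff hG hG_nonneg _ _)
    (fun h hh => hR h hh.1)
  rw [Set.mem_iInter] at hh
  refine ⟨h, (hadm h).2 (hh 0).1, le_of_tendsto' hvlim fun n => ?_⟩
  rw [← hv n]
  exact (hh n).2
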